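/- **Lemma.** For an ideal $I=\langle p_1,\dots,p_r\rangle\subset\mathbb Q[z_1,\dots,z_n]$ let $V(I)\subset\mathbb C^n$ be its set of complex zeros; $I$ is called zero-dimensional if $V(I)$ is finite. A univariate representation of $V(I)$ consists of $a_1,\dots,a_n\in\mathbb Q$ and $f,g_{z_1},\dots,g_{z_n}\in\mathbb Q[t]$ such that the maps $V(I)\to V(f)$, $z\mapsto a_1z_1+\dots+a_nz_n$, and $V(f)\to V(I)$, $\tau\mapsto(g_{z_1}(\tau),\dots,g_{z_n}(\tau))$, where $V(f)=\{\tau\in\mathbb C: f(\tau)=0\}$, are well defined and inverse to each other. For $k\in\{1,\dots,n\}$ put $l_k=\sharp\{z\in V(I) : |z_k|=1\}$. (a) *Computability.* There is an algorithm (a partial recursive function, uniform in $n$, $r$, the $p_i$ and $k$) which, given $n$, the polynomials $p_1,\dots,p_r$ (lists of terms with rational coefficients) and $k$, halts with output $l_k$ whenever $I$ is zero-dimensional. It can be taken to be the composition of the following three procedures: 1. a partial recursive procedure which, for each zero-dimensional $I$, computes from $p_1,\dots,p_r$ a univariate representation of $V(I)$ with $f$ squarefree; 2. a total computable procedure which computes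 the resultant $r_k=\operatorname{Res}_t(f,\,z_k-g_{z_k}(t))\in\mathbb Q[z_k]$ from $f$ and $g_{z_k}$; 3. a total computable procedure which, for each nonzero univariate rational polynomial, computes the exact number of its complex roots on the unit circle, counted with multiplicity. (b) *Correctness of the method.* Let $I\subset\mathbb Q[z_1,\dots,z_n]$ be any zero-dimensional ideal, and take any univariate representation of $V(I)$ with $f$ squarefree, and any $k$. Then there is a nonzero constant $c\in\mathbb C$ with $$r_k=c\prod_{\alpha\in V(I)}(z_k-\alpha_k),$$ the multiplicity of each $w\in\mathbb C$ as a root of $r_k$ is $\sharp\{z\in V(I): z_k=w\}$ (which is $0$ if $w$ is not a root), and the number of complex roots of $r_k$ on the unit circle, counted with multiplicity, equals $l_k$. -/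

import Mathlib

noncomputable section

namespace UnitCircleCount

open Polynomial

/-! ### Varieties and univariate representations -/

/-- The complex variety `V(I) ⊆ ℂⁿ` of an ideal `I` of `ℚ[z₁, …, zₙ]`. -/
def variety {n : ℕ} (I : Ideal (MvPolynomial (Fin n) ℚ)) : Set (Fin n → ℂ) :=
  MvPolynomial.zeroLocus ℂ I

/-- `I` is zero-dimensional: `V(I)` consists of finitely many (possibly zero) complex points. -/
def IsZeroDimensional {n : ℕ} (I : Ideal (MvPolynomial (Fin n) ℚ)) : Prop :=
  (variety I).Finite

/-- The set `V(f)` of complex zeros of a univariate polynomial `f ∈ ℚ[t]`. -/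
def zeros (f : ℚ[X]) : Set ℂ := {τ | aeval τ f = 0}

/-- The linear form `a₁ z₁ + ⋯ + aₙ zₙ`, evaluated at a point of `ℂⁿ`. -/
def linearForm {n : ℕ} (a : Fin n → ℚ) (z : Fin n → ℂ) : ℂ := ∑ i, (a i : ℂ) * z i

/-- `(a, f, g)` is a univariate representation of `V(I)`: the maps
`z ↦ a₁ z₁ + ⋯ + aₙ zₙ` from `V(I)` to `V(f)` and `τ ↦ (g₁(τ), …, gₙ(τ))` from `V(f)` to `V(I)`
are well defined and inverse to each other. -/
structure IsUnivariateRepresentation {n : ℕ} (I : Ideal (MvPolynomial (Fin n) ℚ))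
    (a : Fin n → ℚ) (f : ℚ[X]) (g : Fin n → ℚ[X]) : Prop where
  mapsTo_zeros : Set.MapsTo (linearForm a) (variety I) (zeros f)
  mapsTo_variety : Set.MapsTo (fun τ i => aeval τ (g i)) (zeros f) (variety I)
  invOn : Set.InvOn (fun τ i => aeval τ (g i)) (linearForm a) (variety I) (zeros f)

/-- `l_k`, the number of points `z ∈ V(I)` with `|z_k| = 1`. -/
def unitCount {n : ℕ} (I : Ideal (MvPolynomial (Fin n) ℚ)) (k : Fin n) : ℕ :=
  {z | z ∈ variety I ∧ ‖z k‖ = 1}.ncard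

/-- The resultant of `f(t)` and `z - g(t)` with respect to `t`, a polynomial in `z`.
In `ℚ[X][X]` the outer variable is `t` and the inner (coefficient) variable is `z`. -/
def elimResultant (f g : ℚ[X]) : ℚ[X] :=
  resultant (f.map C) (C X - g.map C)

/-- The number of complex roots of `r`, counted with multiplicity, on the unit circle
(for `r ≠ 0`). -/
def unitCircleRootCount (r : ℚ[X]) : ℕ := by
  classical
  exact ((r.map (algebraMap ℚ ℂ)).roots.filter (fun w => ‖w‖ = 1)).card

/-! ### Finite data on which algorithms operate -/

/-- A rational number is given by natural numbers `(p, q, d)`, standing for `(p - q) / (d + 1)`. -/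
abbrev RatCode := ℕ × ℕ × ℕ

/-- The rational number with a given code. -/
def RatCode.val (c : RatCode) : ℚ := ((c.1 : ℚ) - (c.2.1 : ℚ)) / ((c.2.2 : ℚ) + 1)

/-- A univariate rational polynomial is given by its list of coefficients, constant term first. -/
abbrev PolyCode := List RatCode

/-- The univariate polynomial with a given code. -/
def PolyCode.val : PolyCode → ℚ[X]
  | [] => 0
  | c :: l => C (RatCode.val c) + X * PolyCode.val l

/-- A multivariate rational polynomial is given by a list of terms,
each one a coefficient together with a list of exponents. -/
abbrev MvPolyCode := List (RatCode × List ℕ)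

/-- The polynomial in `z₁, …, zₙ` with a given code: the sum of its terms. Exponents that are
missing from a list are `0`, superfluous ones are ignored. -/
def MvPolyCode.val (n : ℕ) (p : MvPolyCode) : MvPolynomial (Fin n) ℚ :=
  (p.map fun m => MvPolynomial.C (RatCode.val m.1) *
    ∏ i : Fin n, MvPolynomial.X i ^ (m.2.getD i 0)).sum

/-- An ideal is given by the number `n` of variables and a list of generators `p₁, …, p_r`. -/
abbrev IdealCode := ℕ × List MvPolyCode

/-- The ideal `⟨p₁, …, p_r⟩` of `ℚ[z₁, …, zₙ]` generated by the given list. -/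
def idealOf (n : ℕ) (ps : List MvPolyCode) : Ideal (MvPolynomial (Fin n) ℚ) :=
  Ideal.span {p | ∃ c ∈ ps, p = MvPolyCode.val n c}

/-- A univariate representation is given by the lists of the `aᵢ`, the polynomial `f`,
and the list of the `gᵢ`. -/
abbrev URCode := List RatCode × PolyCode × List PolyCode

/-- The coefficient `aᵢ` of the linear form. -/
def URCode.a (u : URCode) (i : ℕ) : ℚ := RatCode.val (u.1.getD i (0, 0, 0))

/-- The polynomial `f`. -/
def URCode.f (u : URCode) : ℚ[X] := PolyCode.val u.2.1

/-- The polynomial `gᵢ`. -/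
def URCode.g (u : URCode) (i : ℕ) : ℚ[X] := PolyCode.val (u.2.2.getD i [])

end UnitCircleCount

end

/-! Correctness rests on Poisson's formula: up to a nonzero constant, the resultant of `f` and `z -
g(t)` is the product of `z - g(τ)` over the roots `τ` of `f` (`map_elimResultant`). A squarefree `f`
has simple roots, a univariate representation matches them with the points of `V(I)`, and under this
matching `g_k(τ)` becomes the coordinate `α_k`. So the multiset of roots of `r_k` is the multiset of
`k`-th coordinates of `V(I)`.

Computability is obtained by certificates. If a correct output can be recognised by a semidecidable
relation, unbounded search finds one (`Semidecidable.exists_partrec`), and it remains to prove that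
an output with a certificate exists. The main certificate is the Nullstellensatz: "every common
complex zero of `p₁, …, p_r` is a zero of `q`" holds exactly when some power of `q` is a combination
of the `pᵢ`, which a search can verify (`semidecidable_implies`).

Univariate representations: a representation says that two algebraic sets in `ℂⁿ⁺¹` coincide, and
squarefreeness says that `f` and `f'` have no common zero; both are such implications. For
existence, points of a finite `V(I)` have algebraic coordinates, a generic rational linear form
separates them, and the nodal and interpolation polynomials of its values are Galois invariant,
hence rational (`exists_isUnivariateRepresentation`).

Resultant: Poisson's formula, quantified over all tuples `x` that list the roots of `f`, is again
such an implication and characterises the resultant (`implies_resultantEquation_iff`).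

Roots on the unit circle: deciding whether `|ζ| = 1` exactly is reduced to approximation. The
factors in `ℚ[X]` are treated one by one. On the unit circle the conjugate is the inverse, so a
monic irreducible factor either has no two roots with product 1, and then no root on the circle, or
its root set is closed under inversion (`aeval_eq_zero_of_irreducible`). In the second case `ζ` and
its reflection `1 / conj ζ` are both roots; once the roots are isolated well enough, a root close to
the circle equals its reflection and lies on the circle (`norm_eq_one_iff_of_near`). -/

namespace UnitCircleCount

open Polynomial

/-! ### Semidecidable predicates -/

section Semidecidable

variable {α β γ : Type*} [Primcodable α] [Primcodable β] [Primcodable γ]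

/-- A predicate is semidecidable if it is the projection of a primitive recursive relation. -/
def Semidecidable (p : α → Prop) : Prop :=
  ∃ c : α → ℕ → Prop, PrimrecRel c ∧ ∀ a, p a ↔ ∃ n, c a n

theorem Semidecidable.of_eq {p q : α → Prop} (hp : Semidecidable p) (h : ∀ a, p a ↔ q a) :
    Semidecidable q := (funext fun a => propext (h a) : p = q) ▸ hp

theorem _root_.PrimrecPred.semidecidable {p : α → Prop} (hp : PrimrecPred p) : Semidecidable p :=
  ⟨fun a _ => p a, hp.comp Primrec.fst, fun _ => by simp⟩

theorem Semidecidable.comp {p : β → Prop} (hp : Semidecidable p) {f : α → β} (hf : Primrec f) :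
    Semidecidable fun a => p (f a) := by
  obtain ⟨c, hc, h⟩ := hp
  exact ⟨fun a n => c (f a) n, hc.comp (hf.comp Primrec.fst) Primrec.snd, fun a => h (f a)⟩

theorem Semidecidable.and {p q : α → Prop} (hp : Semidecidable p) (hq : Semidecidable q) :
    Semidecidable fun a => p a ∧ q a := by
  obtain ⟨c, hc, h⟩ := hp
  obtain ⟨d, hd, h'⟩ := hq
  -- One number codes the pair of witnesses.
  refine ⟨fun a n => c a n.unpair.1 ∧ d a n.unpair.2, ?_, fun a => ?_⟩
  · have h2 : Primrec fun x : α × ℕ => x.2.unpair := Primrec.unpair.comp Primrec.snd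
    exact (hc.comp Primrec.fst (Primrec.fst.comp h2)).and
      (hd.comp Primrec.fst (Primrec.snd.comp h2))
  · change p a ∧ q a ↔ _
    rw [h, h']
    constructor
    · rintro ⟨⟨m, hm⟩, n, hn⟩
      exact ⟨Nat.pair m n, by simp [hm, hn]⟩
    · rintro ⟨n, hm, hn⟩
      exact ⟨⟨_, hm⟩, _, hn⟩

theorem Semidecidable.or {p q : α → Prop} (hp : Semidecidable p) (hq : Semidecidable q) :
    Semidecidable fun a => p a ∨ q a := by
  obtain ⟨c, hc, h⟩ := hp
  obtain ⟨d, hd, h'⟩ := hq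
  exact ⟨fun a n => c a n ∨ d a n, PrimrecPred.or hc hd, fun a => by
    change p a ∨ q a ↔ _
    rw [h, h', exists_or]⟩

theorem Semidecidable.exists {p : α × β → Prop} (hp : Semidecidable p) :
    Semidecidable fun a => ∃ b, p (a, b) := by
  classical
  obtain ⟨c, hc, h⟩ := hp
  -- The witness codes a pair: the element `b` and a witness for `p (a, b)`.
  refine ⟨fun a n => ((Encodable.decode n.unpair.1 : Option β).map
    fun b => decide (c (a, b) n.unpair.2)) = some true, ?_, fun a => ?_⟩
  · have h2 : Primrec fun x : α × ℕ => x.2.unpair := Primrec.unpair.comp Primrec.snd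
    refine Primrec.eq.comp (Primrec.option_map (Primrec.decode.comp (Primrec.fst.comp h2)) ?_)
      (Primrec.const _)
    exact (hc.comp ((Primrec.fst.comp Primrec.fst).pair Primrec.snd)
      (Primrec.snd.comp (h2.comp Primrec.fst))).decide
  · constructor
    · rintro ⟨b, hb⟩
      obtain ⟨n, hn⟩ := (h _).1 hb
      exact ⟨Nat.pair (Encodable.encode b) n, by simp [hn]⟩
    · rintro ⟨n, hn⟩
      obtain ⟨b, -, hb⟩ := Option.map_eq_some_iff.1 hn
      exact ⟨b, (h _).2 ⟨_, of_decide_eq_true hb⟩⟩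

/-- A finite list needs only finitely many witnesses, and a common strict bound for them serves as
the single witness; the remaining quantifiers are bounded. -/
theorem Semidecidable.forall_mem {p : α × β → Prop} (hp : Semidecidable p) :
    Semidecidable fun a : α × List β => ∀ b ∈ a.2, p (a.1, b) := by
  obtain ⟨c, hc, h⟩ := hp
  have h1 : PrimrecRel fun (l : List ℕ) (x : α × β) => ∃ m ∈ l, c x m :=
    PrimrecRel.exists_mem_list (R := fun (m : ℕ) (x : α × β) => c x m) hc.swap
  have h2 : PrimrecRel fun (l : List β) (x : α × ℕ) =>
      ∀ b ∈ l, ∃ m ∈ List.range x.2, c (x.1, b) m :=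
    PrimrecRel.forall_mem_list
      (R := fun (b : β) (x : α × ℕ) => ∃ m ∈ List.range x.2, c (x.1, b) m)
      (h1.comp (Primrec.list_range.comp (Primrec.snd.comp Primrec.snd))
        ((Primrec.fst.comp Primrec.snd).pair Primrec.fst))
  refine ⟨fun a n => ∀ b ∈ a.2, ∃ m ∈ List.range n, c (a.1, b) m,
    h2.comp (Primrec.snd.comp Primrec.fst) ((Primrec.fst.comp Primrec.fst).pair Primrec.snd), ?_⟩
  rintro ⟨a, l⟩
  constructor
  · intro H
    simp only [h, List.mem_range] at H ⊢
    induction l with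
    | nil => simp
    | cons b l ih =>
      obtain ⟨n, hn⟩ := ih fun b hb => H b (List.mem_cons_of_mem _ hb)
      obtain ⟨m, hm⟩ := H b List.mem_cons_self
      refine ⟨max n (m + 1), fun b' hb' => ?_⟩
      rcases List.mem_cons.1 hb' with rfl | hb'
      · exact ⟨m, by omega, hm⟩
      · obtain ⟨k, hk, hk'⟩ := hn b' hb'
        exact ⟨k, by omega, hk'⟩
  · rintro ⟨n, hn⟩ b hb
    obtain ⟨m, -, hm⟩ := hn b hb
    exact (h _).2 ⟨m, hm⟩

theorem Semidecidable.forall_mem_comp {p : α × β → Prop} (hp : Semidecidable p)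
    {f : α → List β} (hf : Primrec f) : Semidecidable fun a => ∀ b ∈ f a, p (a, b) :=
  hp.forall_mem.comp (Primrec.id.pair hf)

/-- Uniformization: a semidecidable relation has a partial recursive choice function. -/
theorem Semidecidable.exists_partrec {p : α × β → Prop} (hp : Semidecidable p) :
    ∃ F : α →. β, Partrec F ∧ (∀ a, ∀ b ∈ F a, p (a, b)) ∧ ∀ a, (∃ b, p (a, b)) → (F a).Dom := by
  classical
  obtain ⟨c, hc, h⟩ := hp
  let g : α → ℕ → Option β := fun a n => (Encodable.decode n.unpair.1 : Option β).bind
    fun b => if c (a, b) n.unpair.2 then some b else none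
  have hg : Primrec₂ g := by
    have h2 : Primrec fun x : α × ℕ => x.2.unpair := Primrec.unpair.comp Primrec.snd
    refine Primrec.option_bind (Primrec.decode.comp (Primrec.fst.comp h2)) ?_
    exact Primrec.ite (hc.comp ((Primrec.fst.comp Primrec.fst).pair Primrec.snd)
      (Primrec.snd.comp (h2.comp Primrec.fst))) (Primrec.option_some.comp Primrec.snd)
      (Primrec.const _)
  refine ⟨fun a => Nat.rfindOpt (g a), Partrec.rfindOpt hg.to_comp, fun a b hb => ?_,
    fun a => ?_⟩
  · obtain ⟨n, hn⟩ := Nat.rfindOpt_spec hb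
    obtain ⟨b', -, hb'⟩ := Option.bind_eq_some_iff.1 hn
    split_ifs at hb' with hif
    cases hb'
    exact (h _).2 ⟨_, hif⟩
  · rintro ⟨b, hb⟩
    obtain ⟨n, hn⟩ := (h _).1 hb
    exact Nat.rfindOpt_dom.2 ⟨Nat.pair (Encodable.encode b) n, b, by simp [g, hn]⟩

/-- Uniformization of a total semidecidable relation. -/
theorem Semidecidable.exists_computable {p : α × β → Prop} (hp : Semidecidable p)
    (h : ∀ a, ∃ b, p (a, b)) : ∃ F : α → β, Computable F ∧ ∀ a, p (a, F a) := by
  obtain ⟨F, hF, hp, hd⟩ := hp.exists_partrec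
  refine ⟨fun a => (F a).get (hd a (h a)), hF.of_eq fun a => ?_, fun a => hp _ _ (Part.get_mem _)⟩
  exact (Part.some_get _).symm

end Semidecidable

/-! ### Arithmetic of codes of rational numbers -/

namespace RatCode

/-- Addition of codes of rational numbers. -/
def add (c d : RatCode) : RatCode :=
  (c.1 * (d.2.2 + 1) + d.1 * (c.2.2 + 1), c.2.1 * (d.2.2 + 1) + d.2.1 * (c.2.2 + 1),
    c.2.2 * d.2.2 + c.2.2 + d.2.2)

/-- Multiplication of codes of rational numbers. -/
def mul (c d : RatCode) : RatCode :=
  (c.1 * d.1 + c.2.1 * d.2.1, c.1 * d.2.1 + c.2.1 * d.1, c.2.2 * d.2.2 + c.2.2 + d.2.2)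

/-- Negation of codes of rational numbers. -/
def neg (c : RatCode) : RatCode := (c.2.1, c.1, c.2.2)

@[simp] theorem val_natCast (i : ℕ) : val (i, 0, 0) = i := by simp [val]

@[simp] theorem val_zero : val (0, 0, 0) = 0 := by simp [val]

@[simp] theorem val_one : val (1, 0, 0) = 1 := by simp [val]

@[simp] theorem val_add (c d : RatCode) : val (add c d) = val c + val d := by
  simp only [val, add]
  have h : ((c.2.2 : ℚ) + 1) ≠ 0 := by positivity
  have h' : ((d.2.2 : ℚ) + 1) ≠ 0 := by positivity
  -- Codes store denominators diminished by one, so that zero denominators do not occur.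
  have h'' : ((c.2.2 * d.2.2 + c.2.2 + d.2.2 : ℕ) : ℚ) + 1 = (c.2.2 + 1) * (d.2.2 + 1) := by
    push_cast; ring
  rw [h'', div_add_div _ _ h h']
  push_cast
  ring

@[simp] theorem val_mul (c d : RatCode) : val (mul c d) = val c * val d := by
  simp only [val, mul]
  have h'' : ((c.2.2 * d.2.2 + c.2.2 + d.2.2 : ℕ) : ℚ) + 1 = (c.2.2 + 1) * (d.2.2 + 1) := by
    push_cast; ring
  rw [h'', div_mul_div_comm]
  push_cast
  ring

@[simp] theorem val_neg (c : RatCode) : val (neg c) = -val c := by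
  simp only [val, neg]
  ring

theorem val_pos_iff (c : RatCode) : 0 < val c ↔ c.2.1 < c.1 := by
  have h : (0 : ℚ) < (c.2.2 : ℚ) + 1 := by positivity
  rw [val, div_pos_iff_of_pos_right h, sub_pos, Nat.cast_lt]

theorem val_eq_zero_iff (c : RatCode) : val c = 0 ↔ c.1 = c.2.1 := by
  have h : (c.2.2 : ℚ) + 1 ≠ 0 := by positivity
  rw [val, div_eq_zero_iff, or_iff_left h, sub_eq_zero, Nat.cast_inj]

theorem val_surjective : Function.Surjective val := by
  intro q
  refine ⟨(q.num.toNat, (-q.num).toNat, q.den - 1), ?_⟩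
  have h1 : ((q.den - 1 : ℕ) : ℚ) + 1 = q.den := by
    rw [Nat.cast_sub q.pos]; simp
  have h2 : (q.num.toNat : ℚ) - ((-q.num).toNat : ℚ) = q.num := by
    have := Int.toNat_sub_toNat_neg q.num
    exact_mod_cast congrArg (Int.cast : ℤ → ℚ) this
  simp only [val, h1, h2, Rat.num_div_den]

theorem primrec_add : Primrec₂ add := by
  have hd1 : Primrec fun x : RatCode × RatCode => x.1.2.2 :=
    Primrec.snd.comp (Primrec.snd.comp Primrec.fst)
  have hd2 : Primrec fun x : RatCode × RatCode => x.2.2.2 :=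
    Primrec.snd.comp (Primrec.snd.comp Primrec.snd)
  have hp1 : Primrec fun x : RatCode × RatCode => x.1.1 := Primrec.fst.comp Primrec.fst
  have hp2 : Primrec fun x : RatCode × RatCode => x.2.1 := Primrec.fst.comp Primrec.snd
  have hq1 : Primrec fun x : RatCode × RatCode => x.1.2.1 :=
    Primrec.fst.comp (Primrec.snd.comp Primrec.fst)
  have hq2 : Primrec fun x : RatCode × RatCode => x.2.2.1 :=
    Primrec.fst.comp (Primrec.snd.comp Primrec.snd)
  have s1 := Primrec.succ.comp hd1
  have s2 := Primrec.succ.comp hd2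
  exact (Primrec.nat_add.comp (Primrec.nat_mul.comp hp1 s2) (Primrec.nat_mul.comp hp2 s1)).pair
    ((Primrec.nat_add.comp (Primrec.nat_mul.comp hq1 s2) (Primrec.nat_mul.comp hq2 s1)).pair
      (Primrec.nat_add.comp (Primrec.nat_add.comp (Primrec.nat_mul.comp hd1 hd2) hd1) hd2))

theorem primrec_mul : Primrec₂ mul := by
  have hd1 : Primrec fun x : RatCode × RatCode => x.1.2.2 :=
    Primrec.snd.comp (Primrec.snd.comp Primrec.fst)
  have hd2 : Primrec fun x : RatCode × RatCode => x.2.2.2 :=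
    Primrec.snd.comp (Primrec.snd.comp Primrec.snd)
  have hp1 : Primrec fun x : RatCode × RatCode => x.1.1 := Primrec.fst.comp Primrec.fst
  have hp2 : Primrec fun x : RatCode × RatCode => x.2.1 := Primrec.fst.comp Primrec.snd
  have hq1 : Primrec fun x : RatCode × RatCode => x.1.2.1 :=
    Primrec.fst.comp (Primrec.snd.comp Primrec.fst)
  have hq2 : Primrec fun x : RatCode × RatCode => x.2.2.1 :=
    Primrec.fst.comp (Primrec.snd.comp Primrec.snd)
  exact (Primrec.nat_add.comp (Primrec.nat_mul.comp hp1 hp2) (Primrec.nat_mul.comp hq1 hq2)).pair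
    ((Primrec.nat_add.comp (Primrec.nat_mul.comp hp1 hq2) (Primrec.nat_mul.comp hq1 hp2)).pair
      (Primrec.nat_add.comp (Primrec.nat_add.comp (Primrec.nat_mul.comp hd1 hd2) hd1) hd2))

theorem primrec_neg : Primrec neg :=
  (Primrec.fst.comp Primrec.snd).pair (Primrec.fst.pair (Primrec.snd.comp Primrec.snd))

theorem primrec_natCast : Primrec fun i : ℕ => ((i, 0, 0) : RatCode) :=
  Primrec.id.pair (Primrec.const _)

theorem primrecPred_pos : PrimrecPred fun c : RatCode => 0 < val c :=
  (Primrec.nat_lt.comp (Primrec.fst.comp Primrec.snd) Primrec.fst).of_eq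
    fun c => (val_pos_iff c).symm

theorem primrecPred_eq_zero : PrimrecPred fun c : RatCode => val c = 0 :=
  (Primrec.eq.comp Primrec.fst (Primrec.fst.comp Primrec.snd)).of_eq
    fun c => (val_eq_zero_iff c).symm

end RatCode

/-! ### Codes of univariate polynomials -/

namespace PolyCode

theorem coeff_val (f : PolyCode) (i : ℕ) : (val f).coeff i = RatCode.val (f.getD i (0, 0, 0)) := by
  induction f generalizing i with
  | nil => simp [val]
  | cons c l ih =>
    cases i with
    | zero => simp [val]
    | succ i => simp [val, ih, coeff_X_mul, coeff_C_succ]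

theorem val_append_singleton (f : PolyCode) (c : RatCode) :
    val (f ++ [c]) = val f + C (RatCode.val c) * X ^ f.length := by
  induction f with
  | nil => simp [val]
  | cons d l ih => simp [val, ih, pow_succ]; ring

theorem degree_val_lt (f : PolyCode) : (val f).degree < f.length := by
  rw [degree_lt_iff_coeff_zero]
  intro m hm
  rw [coeff_val, List.getD_eq_default _ _ (by exact_mod_cast hm), RatCode.val_zero]

/-- Every polynomial of degree at most `d` has a code of length `d + 1`. -/
theorem exists_val_append_singleton (p : ℚ[X]) {d : ℕ} (hd : p.natDegree ≤ d) :
    ∃ (f : PolyCode) (c : RatCode), val (f ++ [c]) = p ∧ f.length = d ∧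
      RatCode.val c = p.coeff d := by
  choose φ hφ using RatCode.val_surjective
  refine ⟨(List.range d).map fun i => φ (p.coeff i), φ (p.coeff d), ?_, by simp, hφ _⟩
  have : (List.range d).map (fun i => φ (p.coeff i)) ++ [φ (p.coeff d)] =
      (List.range (d + 1)).map fun i => φ (p.coeff i) := by simp [List.range_succ]
  rw [this]
  ext i
  rw [coeff_val]
  rcases lt_or_ge i (d + 1) with h | h
  · rw [List.getD_eq_getElem _ _ (by simpa using h)]
    simp [hφ]
  · rw [List.getD_eq_default _ _ (by simpa using h), RatCode.val_zero,
      coeff_eq_zero_of_natDegree_lt (by omega)]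

theorem exists_val_eq (p : ℚ[X]) : ∃ f : PolyCode, val f = p :=
  let ⟨f, c, h, _⟩ := exists_val_append_singleton p le_rfl
  ⟨f ++ [c], h⟩

/-- A code of the derivative. -/
def derivative (f : PolyCode) : PolyCode :=
  -- For a nonempty list the last index reads past the end and contributes a harmless trailing zero.
  (List.range f.length).map fun i => RatCode.mul (i + 1, 0, 0) (f.getD (i + 1) (0, 0, 0))

theorem val_derivative (f : PolyCode) : val (derivative f) = Polynomial.derivative (val f) := by
  ext i
  rw [coeff_val, coeff_derivative, coeff_val, derivative]
  rcases lt_or_ge i f.length with h | h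
  · rw [List.getD_eq_getElem _ _ (by simpa using h)]
    have := RatCode.val_natCast (i + 1)
    simp only [List.getElem_map, List.getElem_range, RatCode.val_mul, this]
    push_cast
    ring
  · rw [List.getD_eq_default _ _ (by simpa using h), List.getD_eq_default f _ (by omega)]
    simp

theorem primrec_derivative : Primrec derivative := by
  refine Primrec.list_map (Primrec.list_range.comp Primrec.list_length) ?_
  have hs : Primrec fun x : PolyCode × ℕ => x.2 + 1 := Primrec.succ.comp Primrec.snd
  exact RatCode.primrec_mul.comp (RatCode.primrec_natCast.comp hs)
    ((Primrec.list_getD _).comp Primrec.fst hs)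

end PolyCode

/-! ### Codes of multivariate polynomials -/

namespace MvPolyCode

variable {n : ℕ}

theorem val_nil : val n [] = 0 := by simp [val]

theorem val_cons (m : RatCode × List ℕ) (p : MvPolyCode) :
    val n (m :: p) = MvPolynomial.C (RatCode.val m.1) *
      ∏ i : Fin n, MvPolynomial.X i ^ (m.2.getD i 0) + val n p := by
  simp [val]

@[simp] theorem val_append (p q : MvPolyCode) : val n (p ++ q) = val n p + val n q := by
  simp [val]

/-- The code of a constant. -/
def const (c : RatCode) : MvPolyCode := [(c, [])]

@[simp] theorem val_const (c : RatCode) : val n (const c) = MvPolynomial.C (RatCode.val c) := by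
  simp [val, const]

/-- The exponents of the product of two monomials. -/
def addExp (e e' : List ℕ) : List ℕ :=
  -- The sum of the lengths is a convenient upper bound for their maximum; the surplus entries are
  -- zero.
  (List.range (e.length + e'.length)).map fun i => e.getD i 0 + e'.getD i 0

theorem getD_addExp (e e' : List ℕ) (i : ℕ) :
    (addExp e e').getD i 0 = e.getD i 0 + e'.getD i 0 := by
  rw [addExp]
  rcases lt_or_ge i (e.length + e'.length) with h | h
  · rw [List.getD_eq_getElem _ _ (by simpa using h)]
    simp
  · rw [List.getD_eq_default _ _ (by simpa using h), List.getD_eq_default e _ (by omega),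
      List.getD_eq_default e' _ (by omega)]

/-- Multiplication of a code by a single term. -/
def mulTerm (m : RatCode × List ℕ) (p : MvPolyCode) : MvPolyCode :=
  p.map fun m' => (RatCode.mul m.1 m'.1, addExp m.2 m'.2)

/-- Multiplication of codes of multivariate polynomials. -/
def mul (p q : MvPolyCode) : MvPolyCode := p.flatMap fun m => mulTerm m q

theorem val_mulTerm (m : RatCode × List ℕ) (p : MvPolyCode) :
    val n (mulTerm m p) = (MvPolynomial.C (RatCode.val m.1) *
      ∏ i : Fin n, MvPolynomial.X i ^ (m.2.getD i 0)) * val n p := by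
  induction p with
  | nil => simp [mulTerm, val_nil]
  | cons m' p ih =>
    rw [mulTerm, List.map_cons, ← mulTerm, val_cons, val_cons, ih]
    simp only [RatCode.val_mul, getD_addExp, pow_add, Finset.prod_mul_distrib, map_mul]
    ring

@[simp] theorem val_mul (p q : MvPolyCode) : val n (mul p q) = val n p * val n q := by
  induction p with
  | nil => simp [mul, val_nil]
  | cons m p ih =>
    rw [mul, List.flatMap_cons, ← mul, val_append, ih, val_mulTerm, val_cons]
    ring

/-- Negation of codes of multivariate polynomials. -/
def neg (p : MvPolyCode) : MvPolyCode := mulTerm ((0, 1, 0), []) p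

@[simp] theorem val_neg (p : MvPolyCode) : val n (neg p) = -val n p := by
  rw [neg, val_mulTerm]
  have : RatCode.val (0, 1, 0) = -1 := by simp [RatCode.val]
  simp [this]

/-- The code of a variable. -/
def var (i : ℕ) : MvPolyCode :=
  [((1, 0, 0), (List.range (i + 1)).map fun j => if j = i then 1 else 0)]

theorem val_var (i : Fin n) : val n (var i) = MvPolynomial.X i := by
  have h (j : Fin n) : ((List.range ((i : ℕ) + 1)).map fun k => if k = (i : ℕ) then 1 else 0).getD
      (j : ℕ) 0 = if j = i then 1 else 0 := by
    rcases lt_or_ge (j : ℕ) (i + 1) with h | h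
    · rw [List.getD_eq_getElem _ _ (by simpa using h)]
      simp [Fin.ext_iff]
    · rw [List.getD_eq_default _ _ (by simpa using h), if_neg]
      rintro rfl
      omega
  rw [var, val_cons, val_nil]
  simp only [h]
  simp [Finset.prod_ite_eq']

/-- The product of a list of codes. -/
def prod (l : List MvPolyCode) : MvPolyCode := l.foldr mul (const (1, 0, 0))

@[simp] theorem val_prod (l : List MvPolyCode) : val n (prod l) = (l.map (val n)).prod := by
  induction l with
  | nil => simp [prod]
  | cons p l ih => rw [prod, List.foldr_cons, ← prod, val_mul, ih, List.map_cons, List.prod_cons]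

/-- The power of a code. -/
def pow (p : MvPolyCode) (k : ℕ) : MvPolyCode := prod ((List.range k).map fun _ => p)

@[simp] theorem val_pow (p : MvPolyCode) (k : ℕ) : val n (pow p k) = val n p ^ k := by
  simp [pow]

theorem val_flatMap {β : Type*} (l : List β) (f : β → MvPolyCode) :
    val n (l.flatMap f) = (l.map fun b => val n (f b)).sum := by
  induction l with
  | nil => simp [val_nil]
  | cons b l ih => simp [ih]

/-- Substitution of a multivariate polynomial into a univariate one. -/
def subst (f : PolyCode) (p : MvPolyCode) : MvPolyCode :=
  f.foldr (fun c q => const c ++ mul p q) []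

@[simp] theorem val_subst (f : PolyCode) (p : MvPolyCode) :
    val n (subst f p) = aeval (val n p) (PolyCode.val f) := by
  induction f with
  | nil => simp [subst, val_nil, PolyCode.val]
  | cons c f ih =>
    rw [subst, List.foldr_cons, ← subst, val_append, val_mul, ih, val_const, PolyCode.val]
    simp [MvPolynomial.algebraMap_eq]

theorem val_surjective : Function.Surjective (val n) := by
  intro p
  induction p using MvPolynomial.induction_on with
  | C a =>
    obtain ⟨c, rfl⟩ := RatCode.val_surjective a
    exact ⟨const c, val_const c⟩
  | add p q hp hq =>
    obtain ⟨c, rfl⟩ := hp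
    obtain ⟨d, rfl⟩ := hq
    exact ⟨c ++ d, val_append c d⟩
  | mul_X p i hp =>
    obtain ⟨c, rfl⟩ := hp
    exact ⟨mul c (var i), by rw [val_mul, val_var]⟩

/-- The exponents of a monomial in `n` variables, in normal form. -/
def normExp (n : ℕ) (e : List ℕ) : List ℕ := (List.range n).map fun i => e.getD i 0

/-- The coefficient in `p` of a monomial in `n` variables, given by its exponents. -/
def coeff (n : ℕ) (p : MvPolyCode) (e : List ℕ) : RatCode :=
  p.foldr (fun m c => if normExp n m.2 = normExp n e then RatCode.add m.1 c else c) (0, 0, 0)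

theorem normExp_eq_iff (e e' : List ℕ) :
    normExp n e = normExp n e' ↔ ∀ i : Fin n, e.getD i 0 = e'.getD i 0 := by
  rw [normExp, normExp, List.map_inj_left]
  exact ⟨fun h i => h i (List.mem_range.2 i.2), fun h i hi => h ⟨i, List.mem_range.1 hi⟩⟩

theorem term_eq_monomial (m : RatCode × List ℕ) :
    MvPolynomial.C (RatCode.val m.1) * ∏ i : Fin n, MvPolynomial.X i ^ (m.2.getD i 0) =
      MvPolynomial.monomial (Finsupp.equivFunOnFinite.symm fun i : Fin n => m.2.getD i 0)
        (RatCode.val m.1) := by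
  rw [MvPolynomial.monomial_eq, Finsupp.prod_fintype _ _ (by simp)]
  simp

theorem val_coeff (p : MvPolyCode) (e : List ℕ) : RatCode.val (coeff n p e) =
    MvPolynomial.coeff (Finsupp.equivFunOnFinite.symm fun i : Fin n => e.getD i 0) (val n p) := by
  induction p with
  | nil => simp [coeff, val_nil]
  | cons m p ih =>
    rw [coeff, List.foldr_cons, ← coeff, val_cons, MvPolynomial.coeff_add, ← ih, term_eq_monomial,
      MvPolynomial.coeff_monomial]
    have : (Finsupp.equivFunOnFinite.symm (fun i : Fin n => m.2.getD i 0) =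
        Finsupp.equivFunOnFinite.symm fun i : Fin n => e.getD i 0) ↔
        normExp n m.2 = normExp n e := by
      rw [normExp_eq_iff, Equiv.apply_eq_iff_eq, funext_iff]
    simp only [this]
    split_ifs <;> simp

/-- Only exponents that occur in the code can have a nonzero coefficient, so finitely many checks
decide whether a polynomial vanishes. This is the zero test behind every certificate. -/
theorem val_eq_zero_iff (p : MvPolyCode) :
    val n p = 0 ↔ ∀ m ∈ p, RatCode.val (coeff n p m.2) = 0 := by
  refine ⟨fun h m _ => by rw [val_coeff, h, MvPolynomial.coeff_zero], fun h => ?_⟩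
  have key (q : MvPolyCode) (s : Fin n →₀ ℕ) (hs : MvPolynomial.coeff s (val n q) ≠ 0) :
      ∃ m ∈ q, (Finsupp.equivFunOnFinite.symm fun i : Fin n => m.2.getD i 0) = s := by
    induction q with
    | nil => simp [val_nil] at hs
    | cons m q ih =>
      by_contra! hne
      rw [val_cons, term_eq_monomial, MvPolynomial.coeff_add, MvPolynomial.coeff_monomial,
        if_neg (hne m List.mem_cons_self), zero_add] at hs
      obtain ⟨m', hm', h'⟩ := ih hs
      exact hne m' (List.mem_cons_of_mem _ hm') h'
  ext s
  by_contra hs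
  obtain ⟨m, hm, rfl⟩ := key p s hs
  exact hs (by rw [← val_coeff, h m hm, MvPolynomial.coeff_zero])

theorem primrec_const : Primrec const :=
  Primrec.list_cons.comp (Primrec.id.pair (Primrec.const _)) (Primrec.const _)

theorem primrec_addExp : Primrec₂ addExp := by
  refine Primrec.list_map (Primrec.list_range.comp (Primrec.nat_add.comp
    (Primrec.list_length.comp Primrec.fst) (Primrec.list_length.comp Primrec.snd))) ?_
  exact Primrec.nat_add.comp
    ((Primrec.list_getD _).comp (Primrec.fst.comp Primrec.fst) Primrec.snd)
    ((Primrec.list_getD _).comp (Primrec.snd.comp Primrec.fst) Primrec.snd)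

theorem primrec_mulTerm : Primrec₂ mulTerm := by
  refine Primrec.list_map Primrec.snd ?_
  have h1 : Primrec fun x : ((RatCode × List ℕ) × MvPolyCode) × (RatCode × List ℕ) => x.1.1 :=
    Primrec.fst.comp Primrec.fst
  exact (RatCode.primrec_mul.comp (Primrec.fst.comp h1) (Primrec.fst.comp Primrec.snd)).pair
    (primrec_addExp.comp (Primrec.snd.comp h1) (Primrec.snd.comp Primrec.snd))

theorem primrec_mul : Primrec₂ mul :=
  Primrec.list_flatMap Primrec.fst
    (primrec_mulTerm.comp Primrec.snd (Primrec.snd.comp Primrec.fst))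

theorem primrec_neg : Primrec neg := primrec_mulTerm.comp (Primrec.const _) Primrec.id

theorem primrec_var : Primrec var := by
  refine Primrec.list_cons.comp ((Primrec.const _).pair ?_) (Primrec.const _)
  refine Primrec.list_map (Primrec.list_range.comp Primrec.succ) ?_
  exact Primrec.ite (Primrec.eq.comp Primrec.snd Primrec.fst) (Primrec.const _) (Primrec.const _)

theorem primrec_prod : Primrec prod := by
  refine Primrec.list_foldr (h := fun _ (x : MvPolyCode × MvPolyCode) => mul x.1 x.2) Primrec.id
    (Primrec.const _) ?_
  exact primrec_mul.comp (Primrec.fst.comp Primrec.snd) (Primrec.snd.comp Primrec.snd)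

theorem primrec_pow : Primrec₂ pow := by
  have h : Primrec₂ fun (x : MvPolyCode × ℕ) (_ : ℕ) => x.1 := Primrec.fst.comp Primrec.fst
  exact primrec_prod.comp (Primrec.list_map (Primrec.list_range.comp Primrec.snd) h)

theorem primrec_subst : Primrec₂ subst := by
  refine Primrec.list_foldr (h := fun (x : PolyCode × MvPolyCode) (y : RatCode × MvPolyCode) =>
    const y.1 ++ mul x.2 y.2) Primrec.fst (Primrec.const _) ?_
  exact Primrec.list_append.comp (primrec_const.comp (Primrec.fst.comp Primrec.snd))
    (primrec_mul.comp (Primrec.snd.comp Primrec.fst) (Primrec.snd.comp Primrec.snd))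

theorem primrec_normExp : Primrec₂ normExp := by
  have h : Primrec₂ fun (x : ℕ × List ℕ) (i : ℕ) => x.2.getD i 0 :=
    (Primrec.list_getD _).comp (Primrec.snd.comp Primrec.fst) Primrec.snd
  exact Primrec.list_map (Primrec.list_range.comp Primrec.fst) h

theorem primrec_coeff : Primrec fun x : ℕ × MvPolyCode × List ℕ => coeff x.1 x.2.1 x.2.2 := by
  have h1 : Primrec fun x : (ℕ × MvPolyCode × List ℕ) × ((RatCode × List ℕ) × RatCode) => x.1.1 :=
    Primrec.fst.comp Primrec.fst
  have h2 : Primrec fun x : (ℕ × MvPolyCode × List ℕ) × ((RatCode × List ℕ) × RatCode) => x.2.1 :=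
    Primrec.fst.comp Primrec.snd
  have h3 : Primrec₂ fun (x : ℕ × MvPolyCode × List ℕ) (y : (RatCode × List ℕ) × RatCode) =>
      if normExp x.1 y.1.2 = normExp x.1 x.2.2 then RatCode.add y.1.1 y.2 else y.2 :=
    Primrec.ite (Primrec.eq.comp (primrec_normExp.comp h1 (Primrec.snd.comp h2))
        (primrec_normExp.comp h1 (Primrec.snd.comp (Primrec.snd.comp Primrec.fst))))
      (RatCode.primrec_add.comp (Primrec.fst.comp h2) (Primrec.snd.comp Primrec.snd))
      (Primrec.snd.comp Primrec.snd)
  have h4 : Primrec fun x : ℕ × MvPolyCode × List ℕ => x.2.1 := Primrec.fst.comp Primrec.snd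
  exact (Primrec.list_foldr h4 (Primrec.const (0, 0, 0)) h3).of_eq fun x => rfl

theorem primrecRel_val_eq_zero : PrimrecRel fun (n : ℕ) (p : MvPolyCode) => val n p = 0 := by
  have hx : Primrec fun y : (RatCode × List ℕ) × (ℕ × MvPolyCode) => (y.2.1, y.2.2, y.1.2) :=
    (Primrec.fst.comp Primrec.snd).pair ((Primrec.snd.comp Primrec.snd).pair
      (Primrec.snd.comp Primrec.fst))
  have hc : Primrec fun y : (RatCode × List ℕ) × (ℕ × MvPolyCode) => coeff y.2.1 y.2.2 y.1.2 :=
    (primrec_coeff.comp hx :)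
  have hR : PrimrecRel fun (m : RatCode × List ℕ) (x : ℕ × MvPolyCode) =>
      RatCode.val (coeff x.1 x.2 m.2) = 0 := RatCode.primrecPred_eq_zero.comp hc
  have h := hR.forall_mem_list
  exact (h.comp Primrec.snd Primrec.id).of_eq fun x => (val_eq_zero_iff x.2).symm

end MvPolyCode

/-! ### Semidecidability of implications between polynomial equations -/

/-- The value of a polynomial in `n` variables at the point `(x₀, …, xₙ₋₁)`. -/
noncomputable def MvPolyCode.ev (n : ℕ) (x : ℕ → ℂ) (p : MvPolyCode) : ℂ :=
  MvPolynomial.aeval (fun i : Fin n => x i) (val n p)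

/-- Every common complex zero of the polynomials `ps` in `n` variables is a zero of `q`. -/
def Implies (n : ℕ) (ps : List MvPolyCode) (q : MvPolyCode) : Prop :=
  ∀ x : ℕ → ℂ, (∀ p ∈ ps, p.ev n x = 0) → q.ev n x = 0

namespace MvPolyCode

variable {n : ℕ} {x : ℕ → ℂ}

@[simp] theorem ev_append (p q : MvPolyCode) : ev n x (p ++ q) = ev n x p + ev n x q := by
  simp [ev]

@[simp] theorem ev_mul (p q : MvPolyCode) : ev n x (mul p q) = ev n x p * ev n x q := by
  simp [ev]

@[simp] theorem ev_neg (p : MvPolyCode) : ev n x (neg p) = -ev n x p := by simp [ev]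

@[simp] theorem ev_const (c : RatCode) : ev n x (const c) = (RatCode.val c : ℂ) := by simp [ev]

@[simp] theorem ev_pow (p : MvPolyCode) (k : ℕ) : ev n x (pow p k) = ev n x p ^ k := by simp [ev]

theorem ev_var {i : ℕ} (hi : i < n) : ev n x (var i) = x i := by
  rw [ev, val_var (⟨i, hi⟩ : Fin n), MvPolynomial.aeval_X]

theorem ev_prod (l : List MvPolyCode) : ev n x (prod l) = (l.map (ev n x)).prod := by
  simp only [ev, val_prod, map_list_prod, List.map_map]
  rfl

theorem ev_prod_range (m : ℕ) (f : ℕ → MvPolyCode) :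
    ev n x (prod ((List.range m).map f)) = ∏ i ∈ Finset.range m, ev n x (f i) := by
  rw [ev_prod]
  induction m with
  | zero => simp
  | succ m ih => simp [List.range_succ, Finset.prod_range_succ, ← ih]

theorem ev_flatMap_range (m : ℕ) (f : ℕ → MvPolyCode) :
    ev n x ((List.range m).flatMap f) = ∑ i ∈ Finset.range m, ev n x (f i) := by
  induction m with
  | zero => simp [ev, val_nil]
  | succ m ih => simp [List.range_succ, ih, Finset.sum_range_succ]

@[simp] theorem ev_subst (f : PolyCode) (p : MvPolyCode) :
    ev n x (subst f p) = aeval (ev n x p) (PolyCode.val f) := by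
  rw [ev, val_subst, ← Polynomial.aeval_algHom_apply]
  rfl

end MvPolyCode

theorem mem_variety_idealOf {n : ℕ} {ps : List MvPolyCode} {x : Fin n → ℂ} :
    x ∈ variety (idealOf n ps) ↔ ∀ p ∈ ps, MvPolynomial.aeval x (MvPolyCode.val n p) = 0 := by
  rw [variety, idealOf, MvPolynomial.zeroLocus_span]
  simp only [Set.mem_ofPred_eq]
  exact ⟨fun h p hp => h _ ⟨p, hp, rfl⟩, by rintro h _ ⟨p, hp, rfl⟩; exact h p hp⟩

/-- Hilbert's Nullstellensatz for rational polynomials and their zeros in the algebraically closed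
field `ℂ`. -/
theorem implies_iff_mem_radical (n : ℕ) (ps : List MvPolyCode) (q : MvPolyCode) :
    Implies n ps q ↔ MvPolyCode.val n q ∈ (idealOf n ps).radical := by
  rw [← MvPolynomial.vanishingIdeal_zeroLocus_eq_radical (K := ℂ),
    MvPolynomial.mem_vanishingIdeal_iff]
  constructor
  · intro h x hx
    -- `Implies` speaks of infinite sequences; the entries from index `n` on are irrelevant and set
    -- to 0.
    have hex (i : Fin n) : (fun j : ℕ => if hj : j < n then x ⟨j, hj⟩ else 0) i = x i := by simp
    have := h (fun j => if hj : j < n then x ⟨j, hj⟩ else 0)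
    simp only [MvPolyCode.ev, hex] at this
    exact this (mem_variety_idealOf.1 hx)
  · exact fun h x hx => h (fun i => x i) (mem_variety_idealOf.2 hx)

theorem mem_idealOf_iff {n : ℕ} {ps : List MvPolyCode} {q : MvPolynomial (Fin n) ℚ} :
    q ∈ idealOf n ps ↔ ∃ L : List (MvPolyCode × MvPolyCode), (∀ y ∈ L, y.2 ∈ ps) ∧
      MvPolyCode.val n (L.flatMap fun y => MvPolyCode.mul y.1 y.2) = q := by
  constructor
  · intro h
    refine Submodule.span_induction ?_ ?_ ?_ ?_ h
    · rintro _ ⟨p, hp, rfl⟩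
      exact ⟨[(MvPolyCode.const (1, 0, 0), p)], by simpa using hp, by simp⟩
    · exact ⟨[], by simp, by simp [MvPolyCode.val_nil]⟩
    · rintro _ _ - - ⟨L, hL, rfl⟩ ⟨L', hL', rfl⟩
      refine ⟨L ++ L', fun y hy => ?_, by simp⟩
      rcases List.mem_append.1 hy with hy | hy
      exacts [hL y hy, hL' y hy]
    · rintro a _ - ⟨L, hL, rfl⟩
      obtain ⟨c, rfl⟩ := MvPolyCode.val_surjective a
      refine ⟨L.map fun y => (MvPolyCode.mul c y.1, y.2), ?_, ?_⟩
      · intro y hy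
        obtain ⟨z, hz, rfl⟩ := List.mem_map.1 hy
        exact hL z hz
      · simp only [MvPolyCode.val_flatMap, List.map_map, Function.comp_def, MvPolyCode.val_mul,
          smul_eq_mul, mul_assoc, List.sum_map_mul_left]
  · rintro ⟨L, hL, rfl⟩
    rw [MvPolyCode.val_flatMap]
    refine list_sum_mem fun q hq => ?_
    obtain ⟨y, hy, rfl⟩ := List.mem_map.1 hq
    rw [MvPolyCode.val_mul]
    exact Ideal.mul_mem_left _ _ (Ideal.subset_span ⟨_, hL y hy, rfl⟩)

/-- The certificate consists of an exponent `N` and a list of pairs (cofactor, generator) whose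
products sum to `q ^ N`; checking it is a membership test and a zero test. -/
theorem semidecidable_implies :
    Semidecidable fun x : ℕ × List MvPolyCode × MvPolyCode => Implies x.1 x.2.1 x.2.2 := by
  have hmem : PrimrecRel fun (y : MvPolyCode × MvPolyCode) (ps : List MvPolyCode) =>
      ∃ p ∈ ps, p = y.2 :=
    (PrimrecRel.exists_mem_list (R := fun p p' : MvPolyCode => p = p') Primrec.eq).comp
      Primrec.snd (Primrec.snd.comp Primrec.fst)
  have hall := hmem.forall_mem_list
  have hsum : Primrec fun L : List (MvPolyCode × MvPolyCode) =>
      L.flatMap fun y => MvPolyCode.mul y.1 y.2 := by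
    have h : Primrec₂ fun (_ : List (MvPolyCode × MvPolyCode)) (y : MvPolyCode × MvPolyCode) =>
        MvPolyCode.mul y.1 y.2 :=
      MvPolyCode.primrec_mul.comp (Primrec.fst.comp Primrec.snd) (Primrec.snd.comp Primrec.snd)
    exact Primrec.list_flatMap Primrec.id h
  let S := (ℕ × List MvPolyCode × MvPolyCode) × (ℕ × List (MvPolyCode × MvPolyCode))
  have hL : Primrec fun x : S => x.2.2 := Primrec.snd.comp Primrec.snd
  have hps : Primrec fun x : S => x.1.2.1 := Primrec.fst.comp (Primrec.snd.comp Primrec.fst)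
  have hq : Primrec fun x : S => x.1.2.2 := Primrec.snd.comp (Primrec.snd.comp Primrec.fst)
  have hN : Primrec fun x : S => x.2.1 := Primrec.fst.comp Primrec.snd
  have hn : Primrec fun x : S => x.1.1 := Primrec.fst.comp Primrec.fst
  have h1 : PrimrecPred fun x : S => ∀ y ∈ x.2.2, ∃ p ∈ x.1.2.1, p = y.2 := hall.comp hL hps
  have hd : Primrec fun x : S => MvPolyCode.pow x.1.2.2 x.2.1 ++
      MvPolyCode.neg (x.2.2.flatMap fun y => MvPolyCode.mul y.1 y.2) :=
    Primrec.list_append.comp (MvPolyCode.primrec_pow.comp hq hN)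
      (MvPolyCode.primrec_neg.comp (hsum.comp hL))
  have h2 : PrimrecPred fun x : S => MvPolyCode.val x.1.1 (MvPolyCode.pow x.1.2.2 x.2.1 ++
      MvPolyCode.neg (x.2.2.flatMap fun y => MvPolyCode.mul y.1 y.2)) = 0 :=
    MvPolyCode.primrecRel_val_eq_zero.comp hn hd
  refine (h1.and h2).semidecidable.exists.of_eq ?_
  rintro ⟨n, ps, q⟩
  rw [implies_iff_mem_radical, Ideal.mem_radical_iff]
  simp only [mem_idealOf_iff, MvPolyCode.val_append, MvPolyCode.val_neg, MvPolyCode.val_pow,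
    add_neg_eq_zero, exists_eq_right, Prod.exists]
  exact exists_congr fun N => exists_congr fun L => and_congr Iff.rfl eq_comm

/-! ### Existence of univariate representations -/

/-- The polynomial ring is Jacobson, so the prime `P` of polynomials vanishing at `z` is the
intersection of the maximal ideals above it. Each of these is the vanishing ideal of a complex
point, which lies in the finite set `V(I)`; so the intersection is finite, and a prime containing a
finite intersection contains one of its members. -/
theorem isMaximal_vanishingIdeal_singleton {n : ℕ} {I : Ideal (MvPolynomial (Fin n) ℚ)}
    (hI : IsZeroDimensional I) {z : Fin n → ℂ} (hz : z ∈ variety I) :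
    (MvPolynomial.vanishingIdeal ℚ {z}).IsMaximal := by
  classical
  set P : Ideal (MvPolynomial (Fin n) ℚ) := MvPolynomial.vanishingIdeal ℚ {z} with hP
  have hIP : I ≤ P := fun p hp => (MvPolynomial.mem_vanishingIdeal_singleton_iff z p).2 (hz p hp)
  let J : Finset (Fin n → ℂ) := hI.toFinset.filter fun x =>
    (MvPolynomial.vanishingIdeal ℚ {x}).IsMaximal ∧ P ≤ MvPolynomial.vanishingIdeal ℚ {x}
  have hprime : P.IsPrime := inferInstance
  have hle : J.inf (fun x => MvPolynomial.vanishingIdeal ℚ {x}) ≤ P := by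
    conv_rhs => rw [← hprime.radical, P.radical_eq_jacobson]
    refine le_sInf ?_
    rintro M ⟨hPM, hM⟩
    obtain ⟨x, rfl⟩ := MvPolynomial.eq_vanishingIdeal_singleton_of_isMaximal ℂ hM
    refine Finset.inf_le (f := fun x => MvPolynomial.vanishingIdeal ℚ {x}) ?_
    refine Finset.mem_filter.2 ⟨hI.mem_toFinset.2 fun p hp => ?_, hM, hPM⟩
    exact (MvPolynomial.mem_vanishingIdeal_singleton_iff x p).1 (hPM (hIP hp))
  obtain ⟨x, hx, hxP⟩ := (Ideal.IsPrime.inf_le' hprime).1 hle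
  obtain ⟨-, hmax, hPx⟩ := Finset.mem_filter.1 hx
  rwa [le_antisymm hPx hxP]

/-- By Zariski's lemma the quotient by a maximal ideal is algebraic over `ℚ`, and evaluation at `z`
sends the class of `X i` to `z i`. -/
theorem isAlgebraic_of_mem_variety {n : ℕ} {I : Ideal (MvPolynomial (Fin n) ℚ)}
    (hI : IsZeroDimensional I) {z : Fin n → ℂ} (hz : z ∈ variety I) (i : Fin n) :
    IsAlgebraic ℚ (z i) := by
  have hM := isMaximal_vanishingIdeal_singleton hI hz
  set P : Ideal (MvPolynomial (Fin n) ℚ) := MvPolynomial.vanishingIdeal ℚ {z} with hP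
  let : Field (MvPolynomial (Fin n) ℚ ⧸ P) := Ideal.Quotient.field P
  have halg : Algebra.IsAlgebraic ℚ (MvPolynomial (Fin n) ℚ ⧸ P) := by
    rw [Algebra.isAlgebraic_iff_isIntegral, ← algebraMap_isIntegral_iff]
    exact MvPolynomial.comp_C_integral_of_surjective_of_isJacobsonRing
      (Ideal.Quotient.mk P) Ideal.Quotient.mk_surjective
  let φ : (MvPolynomial (Fin n) ℚ ⧸ P) →ₐ[ℚ] ℂ := Ideal.Quotient.liftₐ P (MvPolynomial.aeval z)
    fun p hp => (MvPolynomial.mem_vanishingIdeal_singleton_iff z p).1 hp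
  have h := (halg.isAlgebraic (Ideal.Quotient.mk P (MvPolynomial.X i))).algHom φ
  have hφ : φ (Ideal.Quotient.mk P (MvPolynomial.X i)) = z i := MvPolynomial.aeval_X z i
  rwa [hφ] at h

/-- Take `a = (1, t, t², …)`. Two distinct points get equal values only if `t` is a root of the
nonzero polynomial whose coefficients are the differences of their coordinates, and some natural
number avoids the finitely many bad values. -/
theorem exists_injOn_linearForm {n : ℕ} {V : Set (Fin n → ℂ)} (hV : V.Finite) :
    ∃ a : Fin n → ℚ, Set.InjOn (linearForm a) V := by
  classical
  let Q : (Fin n → ℂ) → ℂ[X] := fun d => ∑ i : Fin n, C (d i) * X ^ (i : ℕ)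
  have hQ (d : Fin n → ℂ) (i : Fin n) : (Q d).coeff i = d i := by
    simp [Q, coeff_X_pow, Fin.val_inj]
  let S := (hV.toFinset ×ˢ hV.toFinset).filter fun p => p.1 ≠ p.2
  have hne : ∏ p ∈ S, Q (p.1 - p.2) ≠ 0 := by
    refine Finset.prod_ne_zero_iff.2 fun p hp h => (Finset.mem_filter.1 hp).2 (funext fun i => ?_)
    have := hQ (p.1 - p.2) i
    rw [h, coeff_zero, Pi.sub_apply] at this
    exact (sub_eq_zero.1 this.symm)
  obtain ⟨t, ht⟩ : ∃ t : ℕ, ¬ (∏ p ∈ S, Q (p.1 - p.2)).IsRoot (t : ℂ) := by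
    by_contra! h
    exact hne (eq_zero_of_infinite_isRoot _
      ((Set.infinite_range_of_injective (Nat.cast_injective (R := ℂ))).mono
        (by rintro _ ⟨t, rfl⟩; exact h t)))
  refine ⟨fun i => (t : ℚ) ^ (i : ℕ), fun z hz w hw h => ?_⟩
  by_contra hzw
  refine ht ?_
  rw [IsRoot, eval_prod]
  refine Finset.prod_eq_zero (i := (z, w)) (by simp [S, hz, hw, hzw]) ?_
  simp only [linearForm, ← sub_eq_zero (b := ∑ i, _ * w i), ← Finset.sum_sub_distrib] at h
  simp only [Q, eval_finsetSum, eval_mul, eval_C, eval_pow, eval_X, Pi.sub_apply]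
  rw [← h]
  refine Finset.sum_congr rfl fun i _ => ?_
  push_cast
  ring

/-- Galois descent, coefficient by coefficient; the extension may be infinite. -/
theorem exists_map_eq_of_forall_map_eq {k K : Type*} [Field k] [Field K] [Algebra k K]
    [IsGalois k K] (P : K[X]) (hP : ∀ σ : K ≃ₐ[k] K, P.map (σ : K →+* K) = P) :
    ∃ p : k[X], p.map (algebraMap k K) = P := by
  rw [← mem_lifts, lifts_iff_coeff_lifts]
  intro i
  rw [InfiniteGalois.mem_range_algebraMap_iff_fixed]
  intro σ
  conv_rhs => rw [← hP σ, coeff_map]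
  rfl

theorem exists_isUnivariateRepresentation {n : ℕ} {I : Ideal (MvPolynomial (Fin n) ℚ)}
    (hI : IsZeroDimensional I) : ∃ (a : Fin n → ℚ) (f : ℚ[X]) (g : Fin n → ℚ[X]),
      IsUnivariateRepresentation I a f g ∧ Squarefree f := by
  classical
  obtain ⟨a, ha⟩ := exists_injOn_linearForm hI
  -- All points of `V(I)` already have coordinates in the algebraic numbers `K`, which are Galois
  -- over `ℚ`; `W` is `V(I)` seen in `K`.
  let K := algebraicClosure ℚ ℂ
  have : IsAlgClosure ℚ K := algebraicClosure.isAlgClosure ℚ ℂ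
  have : IsGalois ℚ K := IsAlgClosure.isGalois ℚ K
  let ι : (Fin n → K) → Fin n → ℂ := fun w i => algebraMap K ℂ (w i)
  have hι : Function.Injective ι := fun w w' h =>
    funext fun i => (algebraMap K ℂ).injective (congrFun h i)
  have hfin : (ι ⁻¹' variety I).Finite := hI.preimage hι.injOn
  let W := hfin.toFinset
  have hW (w : Fin n → K) : w ∈ W ↔ ∀ p ∈ I, MvPolynomial.aeval w p = 0 := by
    rw [hfin.mem_toFinset]
    refine forall₂_congr fun p _ => ?_
    have : MvPolynomial.aeval (ι w) p = algebraMap K ℂ (MvPolynomial.aeval w p) :=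
      MvPolynomial.aeval_algebraMap_apply ℂ w p
    rw [this, map_eq_zero]
  have hsurj (z) (hz : z ∈ variety I) : ∃ w ∈ W, ι w = z := by
    refine ⟨fun i => ⟨z i, mem_algebraicClosure_iff.2 (isAlgebraic_of_mem_variety hI hz i)⟩, ?_, rfl⟩
    rw [hfin.mem_toFinset]
    exact hz
  let θ : (Fin n → K) → K := fun w => ∑ i, algebraMap ℚ K (a i) * w i
  have hθι (w : Fin n → K) : linearForm a (ι w) = algebraMap K ℂ (θ w) := by
    simp [linearForm, θ, ι]
  have hθ : Set.InjOn θ W := fun w hw w' hw' h => by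
    refine hι (ha (hfin.mem_toFinset.1 hw) (hfin.mem_toFinset.1 hw') ?_)
    rw [hθι, hθι, h]
  -- The Galois group permutes `W`, because `I` is defined over `ℚ`, and `θ` is equivariant, because
  -- `a` is rational.
  let act (σ : K ≃ₐ[ℚ] K) : (Fin n → K) ≃ (Fin n → K) := Equiv.piCongrRight fun _ => σ.toEquiv
  have hact (σ : K ≃ₐ[ℚ] K) (w) : w ∈ W ↔ act σ w ∈ W := by
    rw [hW, hW]
    refine forall₂_congr fun p _ => ?_
    have : MvPolynomial.aeval (act σ w) p = σ (MvPolynomial.aeval w p) :=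
      (MvPolynomial.comp_aeval_apply (f := w) (σ : K →ₐ[ℚ] K) p).symm
    rw [this]
    exact (map_eq_zero_iff σ σ.injective).symm
  have hθact (σ : K ≃ₐ[ℚ] K) (w) : θ (act σ w) = σ (θ w) := by
    simp [θ, act]
  let F : K[X] := Lagrange.nodal W θ
  obtain ⟨f, hf⟩ : ∃ f : ℚ[X], f.map (algebraMap ℚ K) = F := by
    refine exists_map_eq_of_forall_map_eq F fun σ => ?_
    simp only [F, Lagrange.nodal_eq, Polynomial.map_prod, Polynomial.map_sub, map_X, map_C]
    refine Finset.prod_equiv (act σ) (hact σ) fun w _ => ?_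
    rw [hθact]
    rfl
  have hG (i : Fin n) : ∃ g : ℚ[X], g.map (algebraMap ℚ K) =
      Lagrange.interpolate W θ fun w => w i := by
    refine exists_map_eq_of_forall_map_eq _ fun σ => ?_
    -- Uniqueness of interpolation: applying `σ` permutes the nodes `θ w` and the values `w i` in
    -- the same way.
    refine Lagrange.eq_interpolate_of_eval_eq _ hθ ?_ fun w hw => ?_
    · rw [degree_map]
      exact Lagrange.degree_interpolate_lt _ hθ
    · obtain ⟨w, rfl⟩ := (act σ).surjective w
      rw [hθact, ← hact] at *
      have h : eval ((σ : K →+* K) (θ w)) ((Lagrange.interpolate W θ fun w => w i).map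
          (σ : K →+* K)) = σ (eval (θ w) (Lagrange.interpolate W θ fun w => w i)) :=
        eval_map_apply ..
      rw [Lagrange.eval_interpolate_at_node _ hθ hw] at h
      exact h
  choose g hg using hG
  have haeval (x : K) (p : ℚ[X]) :
      aeval (algebraMap K ℂ x) p = algebraMap K ℂ (eval x (p.map (algebraMap ℚ K))) := by
    rw [aeval_algebraMap_apply, eval_map_algebraMap]
  have hzeros (τ : ℂ) : τ ∈ zeros f ↔ ∃ w ∈ W, linearForm a (ι w) = τ := by
    have : aeval τ f = ∏ w ∈ W, (τ - algebraMap K ℂ (θ w)) := by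
      rw [← aeval_map_algebraMap K, hf]
      simp [F, Lagrange.nodal_eq, map_prod]
    simp only [zeros, Set.mem_ofPred_eq, this, Finset.prod_eq_zero_iff, sub_eq_zero, hθι]
    simp only [eq_comm]
  have hgw (w) (hw : w ∈ W) : (fun i => aeval (linearForm a (ι w)) (g i)) = ι w := by
    funext i
    rw [hθι, haeval, hg, Lagrange.eval_interpolate_at_node _ hθ hw]
  refine ⟨a, f, g, ⟨fun z hz => ?_, fun τ hτ => ?_, fun z hz => ?_, fun τ hτ => ?_⟩, ?_⟩
  · obtain ⟨w, hw, rfl⟩ := hsurj z hz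
    exact (hzeros _).2 ⟨w, hw, rfl⟩
  · obtain ⟨w, hw, rfl⟩ := (hzeros τ).1 hτ
    dsimp only
    rw [hgw w hw]
    exact hfin.mem_toFinset.1 hw
  · obtain ⟨w, hw, rfl⟩ := hsurj z hz
    exact hgw w hw
  · obtain ⟨w, hw, rfl⟩ := (hzeros τ).1 hτ
    dsimp only
    rw [hgw w hw]
  -- The nodes `θ w` are distinct, so `F` is separable, and separability descends from `K` to `ℚ`.
  · refine Separable.squarefree ((separable_map (algebraMap ℚ K)).1 ?_)
    rw [hf]
    exact separable_prod_X_sub_C_iff'.2 hθ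

/-! ### The resultant -/

theorem natDegree_C_X_sub_map_C (g : ℚ[X]) :
    (C (X : ℚ[X]) - g.map C).natDegree = g.natDegree := by
  have h : (g.map (C : ℚ →+* ℚ[X])).natDegree = g.natDegree := natDegree_map_eq_of_injective
    C_injective g
  rw [← neg_sub, natDegree_neg, natDegree_sub_C, h]

/-- Poisson's formula for the eliminating resultant. -/
theorem map_elimResultant (f g : ℚ[X]) : (elimResultant f g).map (algebraMap ℚ ℂ) =
    C (f.leadingCoeff : ℂ) ^ g.natDegree *
      ((f.map (algebraMap ℚ ℂ)).roots.map fun τ => X - C (aeval τ g)).prod := by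
  let φ : ℚ[X] →+* ℂ[X] := mapRingHom (algebraMap ℚ ℂ)
  have hC : φ.comp C = (C : ℂ →+* ℂ[X]).comp (algebraMap ℚ ℂ) :=
    RingHom.ext fun c => map_C _
  have hf : (f.map C).map φ = (f.map (algebraMap ℚ ℂ)).map C := by
    rw [Polynomial.map_map, Polynomial.map_map, hC]
  have hg : (C (X : ℚ[X]) - g.map C).map φ = C X - (g.map (algebraMap ℚ ℂ)).map C := by
    rw [Polynomial.map_sub, map_C, Polynomial.map_map, Polynomial.map_map, hC]
    simp [φ]
  have hm : (f.map (C : ℚ →+* ℚ[X])).natDegree =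
      ((f.map (algebraMap ℚ ℂ)).map (C : ℂ →+* ℂ[X])).natDegree := by
    rw [natDegree_map_eq_of_injective C_injective, natDegree_map_eq_of_injective C_injective,
      natDegree_map]
  have hsplits : (f.map (algebraMap ℚ ℂ)).Splits := IsAlgClosed.splits _
  change φ (elimResultant f g) = _
  -- The resultant carries the two degrees as parameters and they stay those over `ℚ[X]` after the
  -- base change; this is why the degree identities are needed.
  rw [elimResultant, ← resultant_map_map, hf, hg, natDegree_C_X_sub_map_C, hm,
    resultant_eq_prod_eval _ _ _ _ (hsplits.map C), hsplits.roots_map, Multiset.map_map]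
  · congr 1
    · rw [leadingCoeff_map_of_injective C_injective, leadingCoeff_map]
      rfl
    · refine congrArg _ (Multiset.map_congr rfl fun τ _ => ?_)
      simp [aeval_def, eval_map]
  · rw [← hg]
    exact natDegree_map_le.trans (natDegree_C_X_sub_map_C g).le

/-! ### Roots of the resultant and coordinates of the points of `V(I)`. -/

section Correctness

variable {n : ℕ} {I : Ideal (MvPolynomial (Fin n) ℚ)} {a : Fin n → ℚ} {f : ℚ[X]}
  {g : Fin n → ℚ[X]}

theorem exists_map_elimResultant_eq (hI : IsZeroDimensional I)
    (h : IsUnivariateRepresentation I a f g) (hf : Squarefree f) (k : Fin n) :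
    ∃ c : ℂ, c ≠ 0 ∧ (elimResultant f (g k)).map (algebraMap ℚ ℂ) =
      C c * ∏ α ∈ hI.toFinset, (X - C (α k)) := by
  classical
  refine ⟨(f.leadingCoeff : ℂ) ^ (g k).natDegree, pow_ne_zero _ ?_, ?_⟩
  · exact_mod_cast leadingCoeff_ne_zero.2 hf.ne_zero
  have hsep : f.Separable := PerfectField.separable_iff_squarefree.2 hf
  have hnodup : (f.map (algebraMap ℚ ℂ)).roots.Nodup :=
    nodup_roots (hsep.map (f := algebraMap ℚ ℂ))
  have hmem (τ : ℂ) : τ ∈ (f.map (algebraMap ℚ ℂ)).roots.toFinset ↔ τ ∈ zeros f := by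
    rw [Multiset.mem_toFinset, mem_roots (map_ne_zero hf.ne_zero), IsRoot, eval_map_algebraMap]
    rfl
  rw [map_elimResultant, C_pow]
  congr 1
  -- The roots of `f` are simple, so Poisson's product runs over the set `V(f)`, which the
  -- representation identifies with `V(I)`.
  have : (f.map (algebraMap ℚ ℂ)).roots = (f.map (algebraMap ℚ ℂ)).roots.toFinset.val := by
    rw [Multiset.toFinset_val, hnodup.dedup]
  rw [this]
  symm
  refine Finset.prod_nbij' (linearForm a) (fun τ i => aeval τ (g i)) ?_ ?_ ?_ ?_ ?_
  · exact fun z hz => (hmem _).2 (h.mapsTo_zeros (hI.mem_toFinset.1 hz))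
  · exact fun τ hτ => hI.mem_toFinset.2 (h.mapsTo_variety ((hmem _).1 hτ))
  · exact fun z hz => h.invOn.1 (hI.mem_toFinset.1 hz)
  · exact fun τ hτ => h.invOn.2 ((hmem _).1 hτ)
  · intro z hz
    have := congrFun (h.invOn.1 (hI.mem_toFinset.1 hz)) k
    dsimp only at this
    rw [this]

theorem roots_map_elimResultant (hI : IsZeroDimensional I)
    (h : IsUnivariateRepresentation I a f g) (hf : Squarefree f) (k : Fin n) :
    ((elimResultant f (g k)).map (algebraMap ℚ ℂ)).roots =
      hI.toFinset.val.map fun α => α k := by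
  obtain ⟨c, hc, h⟩ := exists_map_elimResultant_eq hI h hf k
  rw [h, roots_C_mul _ hc, Finset.prod]
  have := roots_multiset_prod_X_sub_C (hI.toFinset.val.map fun α => α k)
  rwa [Multiset.map_map] at this

theorem rootMultiplicity_map_elimResultant (hI : IsZeroDimensional I)
    (h : IsUnivariateRepresentation I a f g) (hf : Squarefree f) (k : Fin n) (w : ℂ) :
    ((elimResultant f (g k)).map (algebraMap ℚ ℂ)).rootMultiplicity w =
      {z | z ∈ variety I ∧ z k = w}.ncard := by
  classical
  rw [← count_roots, roots_map_elimResultant hI h hf, Multiset.count_map]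
  have : {z | z ∈ variety I ∧ z k = w} = (hI.toFinset.filter fun z => w = z k : Set _) := by
    ext z
    have := hI.mem_toFinset (a := z)
    simp [this, eq_comm]
  rw [this, Set.ncard_coe_finset]
  rfl

theorem unitCircleRootCount_elimResultant (hI : IsZeroDimensional I)
    (h : IsUnivariateRepresentation I a f g) (hf : Squarefree f) (k : Fin n) :
    unitCircleRootCount (elimResultant f (g k)) = unitCount I k := by
  classical
  rw [unitCircleRootCount, roots_map_elimResultant hI h hf, Multiset.filter_map,
    Multiset.card_map, unitCount]
  have : {z | z ∈ variety I ∧ ‖z k‖ = 1} = (hI.toFinset.filter fun z => ‖z k‖ = 1 : Set _) := by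
    ext z
    have := hI.mem_toFinset (a := z)
    simp [this]
  rw [this, Set.ncard_coe_finset, Finset.card]
  simp only [Finset.filter_val, Function.comp_def]

theorem elimResultant_ne_zero (hI : IsZeroDimensional I)
    (h : IsUnivariateRepresentation I a f g) (hf : Squarefree f) (k : Fin n) :
    elimResultant f (g k) ≠ 0 := by
  obtain ⟨c, hc, h⟩ := exists_map_elimResultant_eq hI h hf k
  intro h0
  rw [h0, Polynomial.map_zero] at h
  refine mul_ne_zero (C_ne_zero.2 hc) (Finset.prod_ne_zero_iff.2 fun α _ => X_sub_C_ne_zero _) h.symm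

end Correctness

/-! ### Computability of the resultant -/

theorem PolyCode.val_eq_val_iff (f g : PolyCode) : PolyCode.val f = PolyCode.val g ↔
    MvPolyCode.val 1 (MvPolyCode.subst f (MvPolyCode.var 0) ++
      MvPolyCode.neg (MvPolyCode.subst g (MvPolyCode.var 0))) = 0 := by
  rw [MvPolyCode.val_append, MvPolyCode.val_neg, add_neg_eq_zero, MvPolyCode.val_subst,
    MvPolyCode.val_subst]
  refine ⟨fun h => by rw [h], fun h => ?_⟩
  have hX : MvPolyCode.val 1 (MvPolyCode.var 0) = MvPolynomial.X 0 := MvPolyCode.val_var (0 : Fin 1)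
  -- Sending the single variable back to `X` inverts the substitution.
  have := congrArg (MvPolynomial.aeval fun _ => (X : ℚ[X])) h
  rw [hX] at this
  simpa [← aeval_algHom_apply] using this

theorem PolyCode.primrecRel_val_eq :
    PrimrecRel fun f g : PolyCode => PolyCode.val f = PolyCode.val g := by
  have h : Primrec fun f : PolyCode => MvPolyCode.subst f (MvPolyCode.var 0) :=
    MvPolyCode.primrec_subst.comp Primrec.id (Primrec.const _)
  have h' : Primrec₂ fun f g : PolyCode => MvPolyCode.subst f (MvPolyCode.var 0) ++
      MvPolyCode.neg (MvPolyCode.subst g (MvPolyCode.var 0)) :=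
    Primrec.list_append.comp (h.comp Primrec.fst) (MvPolyCode.primrec_neg.comp (h.comp Primrec.snd))
  exact (MvPolyCode.primrecRel_val_eq_zero.comp (Primrec.const 1) h').of_eq
    fun x => (PolyCode.val_eq_val_iff x.1 x.2).symm

/-- The code of a polynomial is trimmed: the last coefficient is nonzero,
or it is the only coefficient. -/
def IsTrimmed (c : PolyCode) (a : RatCode) : Prop := RatCode.val a ≠ 0 ∨ c.length = 0

theorem primrecRel_isTrimmed : PrimrecRel IsTrimmed :=
  PrimrecPred.or (RatCode.primrecPred_eq_zero.comp Primrec.snd).not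
    (Primrec.eq.comp (Primrec.list_length.comp Primrec.fst) (Primrec.const 0))

theorem exists_isTrimmed (f : ℚ[X]) : ∃ (c : PolyCode) (a : RatCode),
    PolyCode.val (c ++ [a]) = f ∧ IsTrimmed c a := by
  obtain ⟨c, a, h, hc, ha⟩ := PolyCode.exists_val_append_singleton f le_rfl
  refine ⟨c, a, h, ?_⟩
  rw [IsTrimmed, ha, hc, coeff_natDegree, Ne, leadingCoeff_eq_zero]
  by_cases hf : f = 0
  · exact .inr (by rw [hf, natDegree_zero])
  · exact .inl hf

theorem IsTrimmed.natDegree_val {c : PolyCode} {a : RatCode} (h : IsTrimmed c a) :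
    (PolyCode.val (c ++ [a])).natDegree = c.length := by
  rcases h with h | h
  · rw [PolyCode.val_append_singleton, add_comm, natDegree_add_eq_left_of_degree_lt,
      natDegree_C_mul_X_pow _ _ h]
    rw [degree_C_mul_X_pow _ h]
    exact PolyCode.degree_val_lt c
  · rw [List.length_eq_zero_iff.1 h]
    simp [PolyCode.val]

theorem IsTrimmed.leadingCoeff_val {c : PolyCode} {a : RatCode} (h : IsTrimmed c a) :
    (PolyCode.val (c ++ [a])).leadingCoeff = RatCode.val a := by
  rw [leadingCoeff, h.natDegree_val, PolyCode.coeff_val]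
  simp

open MvPolyCode in
/-- The equations stating that `c + a X ^ m = a ∏ (X - xᵢ)` at the points `0, …, m`. -/
def rootEquations (c : PolyCode) (a : RatCode) : List MvPolyCode :=
  (List.range (c.length + 1)).map fun y => subst (c ++ [a]) (const (y, 0, 0)) ++
    neg (mul (const a) (prod ((List.range c.length).map fun i =>
      const (y, 0, 0) ++ neg (var i))))

open MvPolyCode in
/-- The equation `R (xₘ) = a ^ N ∏ (xₘ - g (xᵢ))`. -/
def resultantEquation (m : ℕ) (a : RatCode) (N : ℕ) (g R : PolyCode) : MvPolyCode :=
  subst R (var m) ++ neg (mul (pow (const a) N)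
    (prod ((List.range m).map fun i => var m ++ neg (subst g (var i)))))

/-- Both sides have degree at most `m = c.length`, so agreement at the `m + 1` points `0, …, m`
forces equality. Evaluation avoids writing down elementary symmetric functions. -/
theorem forall_rootEquations_iff {c : PolyCode} {a : RatCode} (x : ℕ → ℂ) :
    (∀ p ∈ rootEquations c a, p.ev (c.length + 1) x = 0) ↔
      (PolyCode.val (c ++ [a])).map (algebraMap ℚ ℂ) =
        C (RatCode.val a : ℂ) * ∏ i ∈ Finset.range c.length, (X - C (x i)) := by
  have hev (y : ℕ) : MvPolyCode.ev (c.length + 1) x (MvPolyCode.subst (c ++ [a])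
      (MvPolyCode.const (y, 0, 0)) ++ MvPolyCode.neg (MvPolyCode.mul (MvPolyCode.const a)
        (MvPolyCode.prod ((List.range c.length).map fun i =>
          MvPolyCode.const (y, 0, 0) ++ MvPolyCode.neg (MvPolyCode.var i))))) =
      eval (y : ℂ) ((PolyCode.val (c ++ [a])).map (algebraMap ℚ ℂ)) -
        eval (y : ℂ) (C (RatCode.val a : ℂ) * ∏ i ∈ Finset.range c.length, (X - C (x i))) := by
    rw [MvPolyCode.ev_append, MvPolyCode.ev_neg, MvPolyCode.ev_mul, MvPolyCode.ev_prod_range,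
      ← sub_eq_add_neg]
    congr 1
    · simp [eval_map_algebraMap]
    · rw [eval_mul, eval_C, MvPolyCode.ev_const, eval_prod]
      refine congrArg _ (Finset.prod_congr rfl fun i hi => ?_)
      have := Finset.mem_range.1 hi
      rw [MvPolyCode.ev_append, MvPolyCode.ev_neg, MvPolyCode.ev_var (by omega)]
      simp [sub_eq_add_neg]
  simp only [rootEquations, List.forall_mem_map, List.mem_range, hev, sub_eq_zero]
  refine ⟨fun h => ?_, fun h y _ => by rw [h]⟩
  refine eq_of_degrees_lt_of_eval_finset_eq
    ((Finset.range (c.length + 1)).map ⟨(Nat.cast : ℕ → ℂ), Nat.cast_injective⟩) ?_ ?_ ?_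
  · rw [Finset.card_map, Finset.card_range, degree_map]
    simpa using PolyCode.degree_val_lt (c ++ [a])
  · rw [Finset.card_map, Finset.card_range]
    rw [← smul_eq_C_mul]
    refine lt_of_le_of_lt (degree_smul_le _ _) ?_
    rw [degree_prod]
    simpa using Nat.cast_lt.2 (Nat.lt_succ_self c.length)
  · simpa using h

theorem ev_resultantEquation {m : ℕ} {a : RatCode} {N : ℕ} {g R : PolyCode} (x : ℕ → ℂ) :
    (resultantEquation m a N g R).ev (m + 1) x = eval (x m) ((PolyCode.val R).map (algebraMap ℚ ℂ)) -
      eval (x m) (C (RatCode.val a : ℂ) ^ N *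
        ∏ i ∈ Finset.range m, (X - C (aeval (x i) (PolyCode.val g)))) := by
  have hm : MvPolyCode.ev (m + 1) x (MvPolyCode.var m) = x m := MvPolyCode.ev_var (by omega)
  rw [resultantEquation, MvPolyCode.ev_append, MvPolyCode.ev_neg, MvPolyCode.ev_mul,
    MvPolyCode.ev_prod_range, ← sub_eq_add_neg]
  congr 1
  · simp [eval_map_algebraMap, hm]
  · rw [eval_mul, eval_pow, eval_C, MvPolyCode.ev_pow, MvPolyCode.ev_const, eval_prod]
    refine congrArg _ (Finset.prod_congr rfl fun i hi => ?_)
    have := Finset.mem_range.1 hi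
    rw [MvPolyCode.ev_append, MvPolyCode.ev_neg, MvPolyCode.ev_subst,
      MvPolyCode.ev_var (by omega : i < m + 1), hm]
    simp [sub_eq_add_neg]

theorem roots_C_mul_prod {a : ℂ} {m : ℕ} (h : a ≠ 0 ∨ m = 0) (x : ℕ → ℂ) :
    (C a * ∏ i ∈ Finset.range m, (X - C (x i))).roots = (Multiset.range m).map x := by
  rcases h with h | rfl
  · rw [roots_C_mul _ h]
    have := roots_multiset_prod_X_sub_C ((Multiset.range m).map x)
    rwa [Multiset.map_map] at this
  · simp

/-- The premises say that `x₀, …, xₘ₋₁` list the roots of the first polynomial with multiplicity,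
and the conclusion is Poisson's formula at the free point `xₘ`. Trimmed codes ensure that `a`, `m`
and the exponent are the true leading coefficient and degrees. -/
theorem implies_resultantEquation_iff {c c' : PolyCode} {a b : RatCode} {R : PolyCode}
    (h : IsTrimmed c a) (h' : IsTrimmed c' b) :
    Implies (c.length + 1) (rootEquations c a)
        (resultantEquation c.length a c'.length (c' ++ [b]) R) ↔
      PolyCode.val R = elimResultant (PolyCode.val (c ++ [a])) (PolyCode.val (c' ++ [b])) := by
  have key (x : ℕ → ℂ) (hx : (PolyCode.val (c ++ [a])).map (algebraMap ℚ ℂ) =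
      C (RatCode.val a : ℂ) * ∏ i ∈ Finset.range c.length, (X - C (x i))) :
      (elimResultant (PolyCode.val (c ++ [a])) (PolyCode.val (c' ++ [b]))).map (algebraMap ℚ ℂ) =
        C (RatCode.val a : ℂ) ^ c'.length *
          ∏ i ∈ Finset.range c.length, (X - C (aeval (x i) (PolyCode.val (c' ++ [b])))) := by
    rw [map_elimResultant, hx, roots_C_mul_prod (by simpa [IsTrimmed] using h), h.leadingCoeff_val,
      h'.natDegree_val, Multiset.map_map]
    rfl
  have hinj := Polynomial.map_injective (algebraMap ℚ ℂ) (algebraMap ℚ ℂ).injective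
  constructor
  · intro H
    set F := (PolyCode.val (c ++ [a])).map (algebraMap ℚ ℂ) with hF
    have hlead : F.leadingCoeff = (RatCode.val a : ℂ) := by
      rw [hF, leadingCoeff_map, h.leadingCoeff_val]
      rfl
    have hcard : F.roots.toList.length = c.length := by
      rw [Multiset.length_toList, IsAlgClosed.card_roots_eq_natDegree, natDegree_map,
        h.natDegree_val]
    have hroots : (Multiset.range c.length).map (F.roots.toList.getD · 0) = F.roots := by
      conv_rhs => rw [← Multiset.coe_toList F.roots]
      rw [← Multiset.coe_range, Multiset.map_coe, ← hcard]
      congr 1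
      refine List.ext_getElem (by simp) fun i h1 h2 => ?_
      simp [List.getElem?_eq_getElem h2]
    have hfac (x : ℕ → ℂ) (hx : ∀ i < c.length, x i = F.roots.toList.getD i 0) :
        F = C (RatCode.val a : ℂ) * ∏ i ∈ Finset.range c.length, (X - C (x i)) := by
      have h1 := (IsAlgClosed.splits F).eq_prod_roots
      rw [hlead] at h1
      conv_lhs => rw [h1]
      rw [← hroots, Multiset.map_map]
      refine congrArg _ ((Finset.prod_congr rfl fun i hi => ?_ : _ = ∏ i ∈ Finset.range c.length, _))
      rw [hx i (Finset.mem_range.1 hi)]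
      rfl
    refine hinj (Polynomial.funext fun z => ?_)
    -- The premises are satisfiable because `F` splits; with the roots fixed, the last coordinate
    -- `z` is arbitrary, which gives equality of polynomial functions.
    let x : ℕ → ℂ := fun i => if i < c.length then F.roots.toList.getD i 0 else z
    have hxF := hfac x fun i hi => if_pos hi
    have hxm : x c.length = z := if_neg (lt_irrefl _)
    have := H x ((forall_rootEquations_iff x).2 hxF)
    rw [ev_resultantEquation, sub_eq_zero, hxm] at this
    rw [this, key x hxF]
  · intro H x hx
    rw [ev_resultantEquation, H, key x ((forall_rootEquations_iff x).1 hx), sub_self]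

theorem primrec_rootEquations : Primrec₂ rootEquations := by
  let T := (PolyCode × RatCode) × ℕ
  have hc : Primrec fun t : T => t.1.1 := Primrec.fst.comp Primrec.fst
  have ha : Primrec fun t : T => t.1.2 := Primrec.snd.comp Primrec.fst
  have hy : Primrec fun t : T => MvPolyCode.const (t.2, 0, 0) :=
    MvPolyCode.primrec_const.comp (RatCode.primrec_natCast.comp Primrec.snd)
  have hi : Primrec₂ fun (t : T) (i : ℕ) =>
      MvPolyCode.const (t.2, 0, 0) ++ MvPolyCode.neg (MvPolyCode.var i) :=
    Primrec.list_append.comp (hy.comp Primrec.fst)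
      (MvPolyCode.primrec_neg.comp (MvPolyCode.primrec_var.comp Primrec.snd))
  have hl : Primrec fun t : T => (List.range t.1.1.length).map fun i =>
      MvPolyCode.const (t.2, 0, 0) ++ MvPolyCode.neg (MvPolyCode.var i) :=
    Primrec.list_map (Primrec.list_range.comp (Primrec.list_length.comp hc)) hi
  have hs : Primrec fun t : T =>
      MvPolyCode.subst (t.1.1 ++ [t.1.2]) (MvPolyCode.const (t.2, 0, 0)) :=
    MvPolyCode.primrec_subst.comp (Primrec.list_concat.comp hc ha) hy
  have ht : Primrec₂ fun (x : PolyCode × RatCode) (y : ℕ) =>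
      MvPolyCode.subst (x.1 ++ [x.2]) (MvPolyCode.const (y, 0, 0)) ++
        MvPolyCode.neg (MvPolyCode.mul (MvPolyCode.const x.2) (MvPolyCode.prod
          ((List.range x.1.length).map fun i =>
            MvPolyCode.const (y, 0, 0) ++ MvPolyCode.neg (MvPolyCode.var i)))) :=
    Primrec.list_append.comp hs (MvPolyCode.primrec_neg.comp (MvPolyCode.primrec_mul.comp
      (MvPolyCode.primrec_const.comp ha) (MvPolyCode.primrec_prod.comp hl)))
  exact Primrec.list_map (Primrec.list_range.comp (Primrec.succ.comp
    (Primrec.list_length.comp Primrec.fst))) ht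

theorem primrec_resultantEquation :
    Primrec fun x : (ℕ × RatCode) × ℕ × PolyCode × PolyCode =>
      resultantEquation x.1.1 x.1.2 x.2.1 x.2.2.1 x.2.2.2 := by
  let T := (ℕ × RatCode) × ℕ × PolyCode × PolyCode
  have hm : Primrec fun t : T => t.1.1 := Primrec.fst.comp Primrec.fst
  have ha : Primrec fun t : T => t.1.2 := Primrec.snd.comp Primrec.fst
  have hN : Primrec fun t : T => t.2.1 := Primrec.fst.comp Primrec.snd
  have hg : Primrec fun t : T => t.2.2.1 := Primrec.fst.comp (Primrec.snd.comp Primrec.snd)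
  have hR : Primrec fun t : T => t.2.2.2 := Primrec.snd.comp (Primrec.snd.comp Primrec.snd)
  have hv : Primrec fun t : T => MvPolyCode.var t.1.1 := MvPolyCode.primrec_var.comp hm
  have hi : Primrec₂ fun (t : T) (i : ℕ) => MvPolyCode.var t.1.1 ++
      MvPolyCode.neg (MvPolyCode.subst t.2.2.1 (MvPolyCode.var i)) :=
    Primrec.list_append.comp (hv.comp Primrec.fst) (MvPolyCode.primrec_neg.comp
      (MvPolyCode.primrec_subst.comp (hg.comp Primrec.fst)
        (MvPolyCode.primrec_var.comp Primrec.snd)))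
  have hl : Primrec fun t : T => (List.range t.1.1).map fun i => MvPolyCode.var t.1.1 ++
      MvPolyCode.neg (MvPolyCode.subst t.2.2.1 (MvPolyCode.var i)) :=
    Primrec.list_map (Primrec.list_range.comp hm) hi
  exact Primrec.list_append.comp (MvPolyCode.primrec_subst.comp hR hv)
    (MvPolyCode.primrec_neg.comp (MvPolyCode.primrec_mul.comp
      (MvPolyCode.primrec_pow.comp (MvPolyCode.primrec_const.comp ha) hN)
      (MvPolyCode.primrec_prod.comp hl)))

/-- Input codes may end in zeros, so the certificate also contains trimmed codes of the two
polynomials, from which degrees and leading coefficient are read. -/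
theorem semidecidable_elimResultant :
    Semidecidable fun x : (PolyCode × PolyCode) × PolyCode =>
      PolyCode.val x.2 = elimResultant (PolyCode.val x.1.1) (PolyCode.val x.1.2) := by
  let T := ((PolyCode × PolyCode) × PolyCode) × ((PolyCode × RatCode) × (PolyCode × RatCode))
  have hf : Primrec fun t : T => t.1.1.1 := Primrec.fst.comp (Primrec.fst.comp Primrec.fst)
  have hg : Primrec fun t : T => t.1.1.2 := Primrec.snd.comp (Primrec.fst.comp Primrec.fst)
  have hR : Primrec fun t : T => t.1.2 := Primrec.snd.comp Primrec.fst
  have hc : Primrec fun t : T => t.2.1.1 := Primrec.fst.comp (Primrec.fst.comp Primrec.snd)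
  have ha : Primrec fun t : T => t.2.1.2 := Primrec.snd.comp (Primrec.fst.comp Primrec.snd)
  have hc' : Primrec fun t : T => t.2.2.1 := Primrec.fst.comp (Primrec.snd.comp Primrec.snd)
  have hb : Primrec fun t : T => t.2.2.2 := Primrec.snd.comp (Primrec.snd.comp Primrec.snd)
  have hg' : Primrec fun t : T => t.2.2.1 ++ [t.2.2.2] := Primrec.list_concat.comp hc' hb
  have hm : Primrec fun t : T => t.2.1.1.length := Primrec.list_length.comp hc
  have heq : Primrec fun t : T => resultantEquation t.2.1.1.length t.2.1.2 t.2.2.1.length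
      (t.2.2.1 ++ [t.2.2.2]) t.1.2 :=
    (primrec_resultantEquation.comp ((hm.pair ha).pair
      ((Primrec.list_length.comp hc').pair (hg'.pair hR))) :)
  have himp : Semidecidable fun t : T => Implies (t.2.1.1.length + 1)
      (rootEquations t.2.1.1 t.2.1.2) (resultantEquation t.2.1.1.length t.2.1.2 t.2.2.1.length
      (t.2.2.1 ++ [t.2.2.2]) t.1.2) :=
    (semidecidable_implies.comp ((Primrec.succ.comp hm).pair
      ((primrec_rootEquations.comp hc ha).pair heq)) :)
  have h1 : PrimrecPred fun t : T => IsTrimmed t.2.1.1 t.2.1.2 := primrecRel_isTrimmed.comp hc ha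
  have h2 : PrimrecPred fun t : T => IsTrimmed t.2.2.1 t.2.2.2 := primrecRel_isTrimmed.comp hc' hb
  have h3 : PrimrecPred fun t : T => PolyCode.val (t.2.1.1 ++ [t.2.1.2]) = PolyCode.val t.1.1.1 :=
    PolyCode.primrecRel_val_eq.comp (Primrec.list_concat.comp hc ha) hf
  have h4 : PrimrecPred fun t : T => PolyCode.val (t.2.2.1 ++ [t.2.2.2]) = PolyCode.val t.1.1.2 :=
    PolyCode.primrecRel_val_eq.comp hg' hg
  refine (((h1.and h2).and (h3.and h4)).semidecidable.and himp).exists.of_eq ?_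
  rintro ⟨⟨f, g⟩, R⟩
  constructor
  · rintro ⟨⟨⟨c, a⟩, c', b⟩, ⟨⟨ht, ht'⟩, h, h'⟩, H⟩
    dsimp only at *
    rw [← h, ← h']
    exact (implies_resultantEquation_iff ht ht').1 H
  · intro H
    obtain ⟨c, a, h, ht⟩ := exists_isTrimmed (PolyCode.val f)
    obtain ⟨c', b, h', ht'⟩ := exists_isTrimmed (PolyCode.val g)
    refine ⟨⟨⟨c, a⟩, c', b⟩, ⟨⟨ht, ht'⟩, h, h'⟩, ?_⟩
    dsimp only at *
    rw [← h, ← h'] at H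
    exact (implies_resultantEquation_iff ht ht').2 H

theorem exists_computable_elimResultant : ∃ res : URCode × ℕ → PolyCode, Computable res ∧
    ∀ (u : URCode) (k : ℕ),
      PolyCode.val (res (u, k)) = elimResultant (URCode.f u) (URCode.g u k) := by
  obtain ⟨F, hF, h⟩ := semidecidable_elimResultant.exists_computable
    fun x => PolyCode.exists_val_eq (elimResultant (PolyCode.val x.1) (PolyCode.val x.2))
  have hcode : Primrec fun x : URCode × ℕ => (x.1.2.1, x.1.2.2.getD x.2 []) :=
    (Primrec.fst.comp (Primrec.snd.comp Primrec.fst)).pair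
      ((Primrec.list_getD _).comp (Primrec.snd.comp (Primrec.snd.comp Primrec.fst)) Primrec.snd)
  exact ⟨fun x => F (x.1.2.1, x.1.2.2.getD x.2 []), hF.comp hcode.to_comp, fun u k => h _⟩

/-! ### Computability of univariate representations -/

namespace MvPolyCode

/-- Removal of the superfluous exponents of a polynomial in `n` variables. -/
def trunc (n : ℕ) (p : MvPolyCode) : MvPolyCode := p.map fun m => (m.1, normExp n m.2)

/-- An exponent at position `n` is ignored in `n` variables but would count once `xₙ` is adjoined
for the value of the linear form; truncation removes it first. -/
theorem ev_trunc (n : ℕ) (x : ℕ → ℂ) (p : MvPolyCode) :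
    ev (n + 1) x (trunc n p) = ev n x p := by
  induction p with
  | nil => simp [trunc, ev, val_nil]
  | cons m p ih =>
    have h (i : Fin n) : (normExp n m.2).getD i 0 = m.2.getD i 0 := by
      rw [List.getD_eq_getElem _ _ (by simp [normExp])]
      simp [normExp]
    have h' : (normExp n m.2).getD n 0 = 0 := List.getD_eq_default _ _ (by simp [normExp])
    rw [ev, ev] at *
    rw [trunc, List.map_cons, ← trunc, val_cons, val_cons, map_add, map_add, ih,
      Fin.prod_univ_castSucc]
    simp only [Fin.val_castSucc, Fin.val_last, h, h', map_mul, map_prod, map_pow,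
      MvPolynomial.aeval_X, pow_zero, mul_one]
    simp

theorem primrec_trunc : Primrec₂ trunc := by
  have h : Primrec₂ fun (x : ℕ × MvPolyCode) (m : RatCode × List ℕ) => (m.1, normExp x.1 m.2) :=
    (Primrec.fst.comp Primrec.snd).pair (primrec_normExp.comp (Primrec.fst.comp Primrec.fst)
      (Primrec.snd.comp Primrec.snd))
  exact Primrec.list_map Primrec.snd h

end MvPolyCode

open MvPolyCode in
/-- The equations of `V(I)` together with `xₙ = a₀ x₀ + ⋯ + aₙ₋₁ xₙ₋₁`. -/
def idealSystem (s : IdealCode) (u : URCode) : List MvPolyCode :=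
  (var s.1 ++ neg ((List.range s.1).flatMap fun i =>
    mul (const (u.1.getD i (0, 0, 0))) (var i))) :: s.2.map (trunc s.1)

open MvPolyCode in
/-- The equations `f (xₙ) = 0` and `xᵢ = gᵢ (xₙ)`. -/
def representationSystem (s : IdealCode) (u : URCode) : List MvPolyCode :=
  subst u.2.1 (var s.1) :: (List.range s.1).map fun i =>
    var i ++ neg (subst (u.2.2.getD i []) (var s.1))

theorem forall_idealSystem_iff (n : ℕ) (ps : List MvPolyCode) (u : URCode) (x : ℕ → ℂ) :
    (∀ p ∈ idealSystem (n, ps) u, p.ev (n + 1) x = 0) ↔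
      (fun i : Fin n => x i) ∈ variety (idealOf n ps) ∧
        linearForm (fun i : Fin n => u.a i) (fun i : Fin n => x i) = x n := by
  have h1 : MvPolyCode.ev (n + 1) x ((List.range n).flatMap fun i =>
      MvPolyCode.mul (MvPolyCode.const (u.1.getD i (0, 0, 0))) (MvPolyCode.var i)) =
      linearForm (fun i : Fin n => u.a i) (fun i : Fin n => x i) := by
    rw [MvPolyCode.ev_flatMap_range, linearForm, Finset.sum_range]
    refine Finset.sum_congr rfl fun i _ => ?_
    rw [MvPolyCode.ev_mul, MvPolyCode.ev_const, MvPolyCode.ev_var (by omega)]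
    rfl
  rw [idealSystem, List.forall_mem_cons, MvPolyCode.ev_append, MvPolyCode.ev_neg, h1,
    MvPolyCode.ev_var (by simp), add_neg_eq_zero, and_comm, mem_variety_idealOf, List.forall_mem_map]
  refine and_congr (forall₂_congr fun p _ => ?_) eq_comm
  rw [MvPolyCode.ev_trunc]
  rfl

theorem forall_representationSystem_iff (n : ℕ) (ps : List MvPolyCode) (u : URCode) (x : ℕ → ℂ) :
    (∀ p ∈ representationSystem (n, ps) u, p.ev (n + 1) x = 0) ↔
      x n ∈ zeros u.f ∧ (fun i : Fin n => aeval (x n) (u.g i)) = fun i : Fin n => x i := by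
  have hn : MvPolyCode.ev (n + 1) x (MvPolyCode.var n) = x n := MvPolyCode.ev_var (by omega)
  rw [representationSystem, List.forall_mem_cons, MvPolyCode.ev_subst, hn, List.forall_mem_map,
    funext_iff]
  refine and_congr Iff.rfl ⟨fun h i => ?_, fun h i hi => ?_⟩
  · have := h i (List.mem_range.2 i.2)
    rw [MvPolyCode.ev_append, MvPolyCode.ev_neg, MvPolyCode.ev_subst, hn,
      MvPolyCode.ev_var (by omega), add_neg_eq_zero] at this
    exact this.symm
  · have hi := List.mem_range.1 hi
    have := h ⟨i, hi⟩
    dsimp only at hi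
    rw [MvPolyCode.ev_append, MvPolyCode.ev_neg, MvPolyCode.ev_subst, hn,
      MvPolyCode.ev_var (by omega), add_neg_eq_zero]
    exact this.symm

/-- Two maps are mutually inverse exactly when the graph of one is the transpose of the graph of the
other. This turns the definition into an equality of two algebraic sets in `ℂⁿ⁺¹`. -/
theorem isUnivariateRepresentation_iff {n : ℕ} {I : Ideal (MvPolynomial (Fin n) ℚ)}
    {a : Fin n → ℚ} {f : ℚ[X]} {g : Fin n → ℚ[X]} :
    IsUnivariateRepresentation I a f g ↔ ∀ (z : Fin n → ℂ) (τ : ℂ),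
      z ∈ variety I ∧ linearForm a z = τ ↔ τ ∈ zeros f ∧ (fun i => aeval τ (g i)) = z := by
  constructor
  · rintro h z τ
    constructor
    · rintro ⟨hz, rfl⟩
      exact ⟨h.mapsTo_zeros hz, h.invOn.1 hz⟩
    · rintro ⟨hτ, rfl⟩
      exact ⟨h.mapsTo_variety hτ, h.invOn.2 hτ⟩
  · intro h
    exact ⟨fun z hz => ((h z _).1 ⟨hz, rfl⟩).1, fun τ hτ => ((h _ τ).2 ⟨hτ, rfl⟩).1,
      fun z hz => ((h z _).1 ⟨hz, rfl⟩).2, fun τ hτ => ((h _ τ).2 ⟨hτ, rfl⟩).2⟩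

theorem implies_systems_iff (n : ℕ) (ps : List MvPolyCode) (u : URCode) :
    ((∀ q ∈ representationSystem (n, ps) u, Implies (n + 1) (idealSystem (n, ps) u) q) ∧
      ∀ q ∈ idealSystem (n, ps) u, Implies (n + 1) (representationSystem (n, ps) u) q) ↔
      IsUnivariateRepresentation (idealOf n ps) (fun i : Fin n => u.a i) u.f
        (fun i : Fin n => u.g i) := by
  -- A point `(z, τ)` is stored as a sequence with `τ` at index `n`.
  have hx (z : Fin n → ℂ) (τ : ℂ) : ∃ x : ℕ → ℂ, (fun i : Fin n => x i) = z ∧ x n = τ :=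
    ⟨fun i => if hi : i < n then z ⟨i, hi⟩ else τ, by simp, by simp⟩
  rw [isUnivariateRepresentation_iff]
  constructor
  · rintro ⟨h, h'⟩ z τ
    obtain ⟨x, rfl, rfl⟩ := hx z τ
    rw [← forall_idealSystem_iff, ← forall_representationSystem_iff n ps]
    exact ⟨fun H q hq => h q hq x H, fun H q hq => h' q hq x H⟩
  · intro h
    refine ⟨fun q hq x H => ?_, fun q hq x H => ?_⟩
    · rw [forall_idealSystem_iff, h, ← forall_representationSystem_iff n ps] at H
      exact H q hq
    · rw [forall_representationSystem_iff, ← h, ← forall_idealSystem_iff] at H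
      exact H q hq

/-- In characteristic 0, squarefree means that `f` and `f'` have no common zero; inconsistency of a
system is expressed by letting it imply `1 = 0`. -/
theorem implies_derivative_iff (f : PolyCode) :
    Implies 1 [MvPolyCode.subst f (MvPolyCode.var 0),
        MvPolyCode.subst f.derivative (MvPolyCode.var 0)] (MvPolyCode.const (1, 0, 0)) ↔
      Squarefree (PolyCode.val f) := by
  rw [← PerfectField.separable_iff_squarefree, Polynomial.Separable,
    isCoprime_iff_aeval_ne_zero_of_isAlgClosed ℚ ℂ]
  have hx (x : ℕ → ℂ) : MvPolyCode.ev 1 x (MvPolyCode.var 0) = x 0 :=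
    MvPolyCode.ev_var Nat.zero_lt_one
  simp only [Implies, List.forall_mem_cons, MvPolyCode.ev_subst, hx, PolyCode.val_derivative]
  simp only [List.not_mem_nil, false_imp_iff, implies_true, and_true, MvPolyCode.ev_const,
    RatCode.val_one, Rat.cast_one, one_ne_zero, imp_false, not_and_or]
  exact ⟨fun h τ => h fun _ => τ, fun h x => h (x 0)⟩

theorem primrec_idealSystem : Primrec₂ idealSystem := by
  let T := IdealCode × URCode
  have hn : Primrec fun t : T => t.1.1 := Primrec.fst.comp Primrec.fst
  have hps : Primrec fun t : T => t.1.2 := Primrec.snd.comp Primrec.fst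
  have ha : Primrec fun t : T => t.2.1 := Primrec.fst.comp Primrec.snd
  have h1 : Primrec₂ fun (t : T) (i : ℕ) =>
      MvPolyCode.mul (MvPolyCode.const (t.2.1.getD i (0, 0, 0))) (MvPolyCode.var i) :=
    MvPolyCode.primrec_mul.comp (MvPolyCode.primrec_const.comp
      ((Primrec.list_getD _).comp (ha.comp Primrec.fst) Primrec.snd))
      (MvPolyCode.primrec_var.comp Primrec.snd)
  have h2 : Primrec fun t : T => (List.range t.1.1).flatMap fun i =>
      MvPolyCode.mul (MvPolyCode.const (t.2.1.getD i (0, 0, 0))) (MvPolyCode.var i) :=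
    Primrec.list_flatMap (Primrec.list_range.comp hn) h1
  have h3 : Primrec₂ fun (t : T) (p : MvPolyCode) => MvPolyCode.trunc t.1.1 p :=
    MvPolyCode.primrec_trunc.comp (hn.comp Primrec.fst) Primrec.snd
  exact Primrec.list_cons.comp (Primrec.list_append.comp (MvPolyCode.primrec_var.comp hn)
    (MvPolyCode.primrec_neg.comp h2)) (Primrec.list_map hps h3)

theorem primrec_representationSystem : Primrec₂ representationSystem := by
  let T := IdealCode × URCode
  have hn : Primrec fun t : T => t.1.1 := Primrec.fst.comp Primrec.fst
  have hv : Primrec fun t : T => MvPolyCode.var t.1.1 := MvPolyCode.primrec_var.comp hn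
  have hf : Primrec fun t : T => t.2.2.1 := Primrec.fst.comp (Primrec.snd.comp Primrec.snd)
  have hg : Primrec fun t : T => t.2.2.2 := Primrec.snd.comp (Primrec.snd.comp Primrec.snd)
  have h1 : Primrec₂ fun (t : T) (i : ℕ) => MvPolyCode.var i ++ MvPolyCode.neg
      (MvPolyCode.subst (t.2.2.2.getD i []) (MvPolyCode.var t.1.1)) :=
    Primrec.list_append.comp (MvPolyCode.primrec_var.comp Primrec.snd)
      (MvPolyCode.primrec_neg.comp (MvPolyCode.primrec_subst.comp
        ((Primrec.list_getD _).comp (hg.comp Primrec.fst) Primrec.snd) (hv.comp Primrec.fst)))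
  exact Primrec.list_cons.comp (MvPolyCode.primrec_subst.comp hf hv)
    (Primrec.list_map (Primrec.list_range.comp hn) h1)

theorem semidecidable_forall_mem_implies : Semidecidable
    fun x : (ℕ × List MvPolyCode) × List MvPolyCode => ∀ q ∈ x.2, Implies x.1.1 x.1.2 q := by
  have h : Primrec fun x : (ℕ × List MvPolyCode) × MvPolyCode => (x.1.1, x.1.2, x.2) :=
    (Primrec.fst.comp Primrec.fst).pair ((Primrec.snd.comp Primrec.fst).pair Primrec.snd)
  have h' : Semidecidable fun x : (ℕ × List MvPolyCode) × MvPolyCode => Implies x.1.1 x.1.2 x.2 :=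
    (semidecidable_implies.comp h :)
  exact h'.forall_mem

theorem semidecidable_isUnivariateRepresentation : Semidecidable fun x : IdealCode × URCode =>
    IsUnivariateRepresentation (idealOf x.1.1 x.1.2) (fun i : Fin x.1.1 => x.2.a i) x.2.f
      (fun i : Fin x.1.1 => x.2.g i) ∧ Squarefree x.2.f := by
  let T := IdealCode × URCode
  have hn : Primrec fun t : T => t.1.1 + 1 := Primrec.succ.comp (Primrec.fst.comp Primrec.fst)
  have hf : Primrec fun t : T => t.2.2.1 := Primrec.fst.comp (Primrec.snd.comp Primrec.snd)
  have hA : Primrec fun t : T => idealSystem t.1 t.2 :=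
    primrec_idealSystem.comp Primrec.fst Primrec.snd
  have hB : Primrec fun t : T => representationSystem t.1 t.2 :=
    primrec_representationSystem.comp Primrec.fst Primrec.snd
  have h1 : Semidecidable fun t : T => ∀ q ∈ representationSystem t.1 t.2,
      Implies (t.1.1 + 1) (idealSystem t.1 t.2) q :=
    (semidecidable_forall_mem_implies.comp ((hn.pair hA).pair hB) :)
  have h2 : Semidecidable fun t : T => ∀ q ∈ idealSystem t.1 t.2,
      Implies (t.1.1 + 1) (representationSystem t.1 t.2) q :=
    (semidecidable_forall_mem_implies.comp ((hn.pair hB).pair hA) :)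
  have hs : Primrec fun f : PolyCode => MvPolyCode.subst f (MvPolyCode.var 0) :=
    MvPolyCode.primrec_subst.comp Primrec.id (Primrec.const _)
  have hl : Primrec fun t : T => [MvPolyCode.subst t.2.2.1 (MvPolyCode.var 0),
      MvPolyCode.subst t.2.2.1.derivative (MvPolyCode.var 0)] :=
    Primrec.list_cons.comp (hs.comp hf) (Primrec.list_cons.comp
      (hs.comp (PolyCode.primrec_derivative.comp hf)) (Primrec.const []))
  have h3 : Semidecidable fun t : T => Implies 1 [MvPolyCode.subst t.2.2.1 (MvPolyCode.var 0),
      MvPolyCode.subst t.2.2.1.derivative (MvPolyCode.var 0)] (MvPolyCode.const (1, 0, 0)) :=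
    (semidecidable_implies.comp ((Primrec.const 1).pair (hl.pair (Primrec.const _))) :)
  refine ((h1.and h2).and h3).of_eq ?_
  rintro ⟨⟨n, ps⟩, u⟩
  exact and_congr (implies_systems_iff n ps u) (implies_derivative_iff u.2.1)

theorem exists_code_isUnivariateRepresentation {n : ℕ} {I : Ideal (MvPolynomial (Fin n) ℚ)}
    (hI : IsZeroDimensional I) : ∃ u : URCode,
      IsUnivariateRepresentation I (fun i : Fin n => u.a i) u.f (fun i : Fin n => u.g i) ∧
        Squarefree u.f := by
  obtain ⟨a, f, g, h, hf⟩ := exists_isUnivariateRepresentation hI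
  choose a' ha using fun i => RatCode.val_surjective (a i)
  choose g' hg using fun i => PolyCode.exists_val_eq (g i)
  obtain ⟨f', rfl⟩ := PolyCode.exists_val_eq f
  refine ⟨(List.ofFn a', f', List.ofFn g'), ?_, hf⟩
  have h1 (i : Fin n) : URCode.a (List.ofFn a', f', List.ofFn g') i = a i := by
    rw [URCode.a, List.getD_eq_getElem _ _ (by simp)]
    simp [ha]
  have h2 (i : Fin n) : URCode.g (List.ofFn a', f', List.ofFn g') i = g i := by
    rw [URCode.g, List.getD_eq_getElem _ _ (by simp)]
    simp [hg]
  simp only [h1, h2]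
  exact h

theorem exists_partrec_isUnivariateRepresentation : ∃ univRep : IdealCode →. URCode,
    Partrec univRep ∧
    (∀ n ps, ∀ u ∈ univRep (n, ps), IsUnivariateRepresentation (idealOf n ps)
      (fun i : Fin n => u.a i) u.f (fun i : Fin n => u.g i) ∧ Squarefree u.f) ∧
    ∀ n ps, IsZeroDimensional (idealOf n ps) → (univRep (n, ps)).Dom := by
  obtain ⟨F, hF, h, hd⟩ := semidecidable_isUnivariateRepresentation.exists_partrec
  exact ⟨F, hF, fun n ps u hu => h _ u hu,
    fun n ps hI => hd (n, ps) (exists_code_isUnivariateRepresentation hI)⟩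

/-! ### Isolating the roots on the unit circle -/

/-- `|s(w)|` is the product of the distances from `w` to the roots; if all were at least `δ`, the
product would be at least `δ ^ d`. -/
theorem exists_root_norm_sub_lt {s : ℂ[X]} (hs : s.Monic) {w : ℂ} {δ : ℝ} (hδ : 0 < δ)
    (h : ‖s.eval w‖ < δ ^ s.natDegree) : ∃ ζ ∈ s.roots, ‖w - ζ‖ < δ := by
  by_contra! H
  refine absurd h (not_lt.2 ?_)
  have hs' := IsAlgClosed.splits s
  have h1 : s.eval w = (s.roots.map fun ζ => w - ζ).prod := by
    conv_lhs => rw [hs'.eq_prod_roots, hs.leadingCoeff, C_1, one_mul]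
    rw [eval_multiset_prod, Multiset.map_map]
    simp
  rw [h1, ← IsAlgClosed.card_roots_eq_natDegree]
  generalize s.roots = m at H
  induction m using Multiset.induction_on with
  | empty => simp
  | cons ζ m ih =>
    rw [Multiset.card_cons, pow_succ', Multiset.map_cons, Multiset.prod_cons, norm_mul]
    exact mul_le_mul (H ζ (Multiset.mem_cons_self _ _))
      (ih fun ξ hξ => H ξ (Multiset.mem_cons_of_mem hξ)) (by positivity) (norm_nonneg _)

/-- If `|ζ| = 1`, then `| |w|² - 1 | < 2δ + δ² < 3δ`. Conversely, `| |w|² - 1 | ≤ 3δ` puts `r = |ζ|`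
within `4δ` of 1, so `r > 4/5` and the distance `|r² - 1| / r` from `ζ` to its reflection in the
circle is below `18δ`. The hypothesis `h` then makes `ζ` its own reflection. -/
theorem norm_eq_one_iff_of_near {ζ w : ℂ} {δ : ℝ} (hδ : 0 < δ) (hδ' : δ < 1 / 20)
    (hw : ‖w - ζ‖ < δ)
    (h : ζ ≠ 0 → ‖ζ - (starRingEnd ℂ ζ)⁻¹‖ < 18 * δ → ζ = (starRingEnd ℂ ζ)⁻¹) :
    ‖ζ‖ = 1 ↔ (‖w‖ ^ 2 - 1) ^ 2 ≤ 9 * δ ^ 2 := by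
  have h1 : |‖w‖ - ‖ζ‖| < δ := (abs_norm_sub_norm_le w ζ).trans_lt hw
  rw [abs_lt] at h1
  have h3 : (9 * δ ^ 2) = (3 * δ) ^ 2 := by ring
  rw [h3, sq_le_sq, abs_of_pos (by positivity : 0 < 3 * δ), abs_le]
  constructor
  · intro hζ
    rw [hζ] at h1
    constructor <;> nlinarith
  · rintro ⟨h4, h5⟩
    have hw0 := norm_nonneg w
    have h6 : ‖w‖ ≤ 1 + 3 * δ := by nlinarith
    have h7 : 1 - 3 * δ ≤ ‖w‖ := by nlinarith
    set r := ‖ζ‖ with hr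
    have hr0 : 0 < r := by linarith
    have hζ : ζ ≠ 0 := norm_pos_iff.1 hr0
    have hc : starRingEnd ℂ ζ ≠ 0 := (_root_.map_ne_zero _).2 hζ
    have h8 : ζ - (starRingEnd ℂ ζ)⁻¹ = ((r ^ 2 - 1 : ℝ) : ℂ) / starRingEnd ℂ ζ := by
      field_simp
      rw [Complex.mul_conj, Complex.normSq_eq_norm_sq]
      push_cast
      ring
    have h9 : ‖ζ - (starRingEnd ℂ ζ)⁻¹‖ < 18 * δ := by
      rw [h8, norm_div, RCLike.norm_conj, ← hr, div_lt_iff₀ hr0, Complex.norm_real,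
        Real.norm_eq_abs, abs_lt]
      constructor <;> nlinarith
    have h10 : ζ * starRingEnd ℂ ζ = 1 := by
      nth_rewrite 1 [h hζ h9]
      exact inv_mul_cancel₀ hc
    rw [Complex.mul_conj, Complex.normSq_eq_norm_sq] at h10
    have h11 : r ^ 2 = 1 := by exact_mod_cast h10
    nlinarith

/-- Each centre has a root within `δ`, and separation makes these roots distinct, so they are all
`d` roots. Closure under reflection then decides for each disc whether its root is on the circle. -/
theorem card_filter_roots_eq_countP {s : ℂ[X]} (hs : s.Monic) {w : ℕ → ℂ} {δ : ℝ} (hδ : 0 < δ)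
    (hδ' : δ < 1 / 20)
    (hsep : ∀ i < s.natDegree, ∀ j < s.natDegree, i ≠ j → 20 * δ < ‖w i - w j‖)
    (hroot : ∀ i < s.natDegree, ‖s.eval (w i)‖ < δ ^ s.natDegree)
    (hinv : ∀ ζ ∈ s.roots, ζ ≠ 0 → (starRingEnd ℂ ζ)⁻¹ ∈ s.roots)
    (p : ℂ → Prop) [DecidablePred p] (hp : ∀ ζ, p ζ ↔ ‖ζ‖ = 1)
    (q : ℕ → Prop) [DecidablePred q] (hq : ∀ i, q i ↔ (‖w i‖ ^ 2 - 1) ^ 2 ≤ 9 * δ ^ 2) :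
    (s.roots.filter p).card = (List.range s.natDegree).countP fun i => q i := by
  have hex (i : ℕ) : ∃ ζ, i < s.natDegree → ζ ∈ s.roots ∧ ‖w i - ζ‖ < δ := by
    by_cases hi : i < s.natDegree
    · obtain ⟨ζ, h⟩ := exists_root_norm_sub_lt hs hδ (hroot i hi)
      exact ⟨ζ, fun _ => h⟩
    · exact ⟨0, fun h => absurd h hi⟩
  choose ζ hζ using hex
  -- Centres are more than `20δ` apart and each root is within `δ` of its centre, which leaves `18δ`
  -- between distinct roots.
  have hij {i j : ℕ} (hi : i < s.natDegree) (hj : j < s.natDegree)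
      (h : ‖ζ i - ζ j‖ < 18 * δ) : i = j := by
    by_contra hne
    have h1 := hsep i hi j hj hne
    have h2 : w i - w j = (w i - ζ i) + (ζ i - ζ j) - (w j - ζ j) := by ring
    have h3 := norm_sub_le ((w i - ζ i) + (ζ i - ζ j)) (w j - ζ j)
    have h4 := norm_add_le (w i - ζ i) (ζ i - ζ j)
    rw [← h2] at h3
    linarith [(hζ i hi).2, (hζ j hj).2]
  have hroots : (Multiset.range s.natDegree).map ζ = s.roots := by
    refine Multiset.eq_of_le_of_card_le ?_ ?_
    · rw [Multiset.le_iff_subset]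
      · intro z hz
        obtain ⟨i, hi, rfl⟩ := Multiset.mem_map.1 hz
        exact (hζ i (Multiset.mem_range.1 hi)).1
      · refine Multiset.Nodup.map_on ?_ (Multiset.nodup_range _)
        intro i hi j hj h
        refine hij (Multiset.mem_range.1 hi) (Multiset.mem_range.1 hj) ?_
        rw [h, sub_self, norm_zero]
        positivity
    · rw [Multiset.card_map, Multiset.card_range]
      exact card_roots' s
  rw [← Multiset.countP_eq_card_filter, ← hroots, Multiset.countP_map, ← Multiset.coe_range,
    ← Multiset.countP_eq_card_filter, Multiset.coe_countP]
  refine List.countP_congr fun i hi => ?_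
  have hi' := List.mem_range.1 hi
  rw [decide_eq_true_iff, decide_eq_true_iff, hp, hq]
  refine norm_eq_one_iff_of_near hδ hδ' (hζ i hi').2 fun h0 hn => ?_
  have hmem := hinv _ (hζ i hi').1 h0
  rw [← hroots] at hmem
  obtain ⟨j, hj, hj'⟩ := Multiset.mem_map.1 hmem
  rw [← hj'] at hn ⊢
  rw [← hij hi' (Multiset.mem_range.1 hj) hn]

theorem denseRange_ratComplex : DenseRange fun q : ℚ × ℚ => (q.1 : ℂ) + (q.2 : ℂ) * Complex.I := by
  have h : DenseRange (Prod.map (Rat.cast : ℚ → ℝ) (Rat.cast : ℚ → ℝ)) :=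
    Rat.denseRange_cast.prodMap Rat.denseRange_cast
  have h' := Complex.equivRealProdCLM.symm.surjective.denseRange.comp h
    Complex.equivRealProdCLM.symm.continuous
  convert h' using 1
  funext q
  apply Complex.ext <;> simp

/-- Simple roots can be isolated by discs with centers in `ℚ(i)` and arbitrarily small radius. -/
theorem exists_isolating_discs {s : ℂ[X]} (hs : s.roots.Nodup) :
    ∃ (δ : ℚ) (w : ℕ → ℚ × ℚ), 0 < δ ∧ δ < 1 / 20 ∧
      (∀ i < s.natDegree, ∀ j < s.natDegree, i ≠ j → 20 * (δ : ℝ) <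
        ‖((w i).1 + (w i).2 * Complex.I : ℂ) - ((w j).1 + (w j).2 * Complex.I)‖) ∧
      ∀ i < s.natDegree, ‖s.eval ((w i).1 + (w i).2 * Complex.I : ℂ)‖ < (δ : ℝ) ^ s.natDegree := by
  classical
  set d := s.natDegree with hd
  let ζ : ℕ → ℂ := fun i => s.roots.toList.getD i 0
  have hlen : s.roots.toList.length = d := by
    rw [Multiset.length_toList, IsAlgClosed.card_roots_eq_natDegree]
  have hnd : s.roots.toList.Nodup := by rwa [← Multiset.coe_nodup, Multiset.coe_toList]
  have hζ (i) (hi : i < d) : s.eval (ζ i) = 0 := by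
    have : ζ i ∈ s.roots := by
      rw [← Multiset.mem_toList]
      simp only [ζ]
      rw [List.getD_eq_getElem _ _ (by omega)]
      exact List.getElem_mem _
    exact isRoot_of_mem_roots this
  have hne (i) (hi : i < d) (j) (hj : j < d) (hij : i ≠ j) : ζ i ≠ ζ j := by
    simp only [ζ]
    rw [List.getD_eq_getElem _ _ (by omega), List.getD_eq_getElem _ _ (by omega)]
    exact fun h => hij ((hnd.getElem_inj_iff).1 h)
  -- With `δ = 1 / n`, roots more than `22δ` apart have approximations more than `20δ` apart; `n ≥
  -- 21` below gives `δ < 1 / 20`.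
  have hlim : Filter.Tendsto (fun n : ℕ => (22 : ℝ) / n) Filter.atTop (nhds 0) :=
    tendsto_const_div_atTop_nhds_zero_nat 22
  have hev : ∀ᶠ n : ℕ in Filter.atTop, ∀ p ∈ Finset.range d ×ˢ Finset.range d,
      p.1 ≠ p.2 → 22 / (n : ℝ) < ‖ζ p.1 - ζ p.2‖ := by
    rw [Filter.eventually_all_finset]
    rintro ⟨i, j⟩ hp
    rw [Finset.mem_product, Finset.mem_range, Finset.mem_range] at hp
    by_cases hij : i = j
    · exact Filter.Eventually.of_forall fun n h => absurd hij h
    · have hpos : 0 < ‖ζ i - ζ j‖ := norm_pos_iff.2 (sub_ne_zero.2 (hne i hp.1 j hp.2 hij))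
      exact (hlim.eventually (gt_mem_nhds hpos)).mono fun n hn _ => hn
  obtain ⟨n, hn, hn'⟩ := (hev.and (Filter.eventually_ge_atTop 21)).exists
  have hn0 : (0 : ℝ) < n := by
    have : (21 : ℝ) ≤ n := by exact_mod_cast hn'
    linarith
  have hδ : (0 : ℝ) < 1 / n := by positivity
  have hw (i : ℕ) : ∃ q : ℚ × ℚ, i < d → ‖((q.1 : ℂ) + q.2 * Complex.I) - ζ i‖ < 1 / n ∧
      ‖s.eval ((q.1 : ℂ) + q.2 * Complex.I)‖ < (1 / n : ℝ) ^ d := by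
    by_cases hi : i < d
    -- Both conditions are open and hold at the root itself, so the dense set `ℚ(i)` contains a
    -- suitable centre.
    · have hopen : IsOpen ({w : ℂ | ‖w - ζ i‖ < 1 / n} ∩ {w : ℂ | ‖s.eval w‖ < (1 / n : ℝ) ^ d}) :=
        (isOpen_lt (by fun_prop) continuous_const).inter
          (isOpen_lt (s.continuous.norm) continuous_const)
      obtain ⟨q, hq⟩ := denseRange_ratComplex.exists_mem_open hopen
        ⟨ζ i, by simpa using hn0, by simpa [hζ i hi] using pow_pos hδ d⟩
      exact ⟨q, fun _ => hq⟩
    · exact ⟨0, fun h => absurd h hi⟩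
  choose w hw using hw
  refine ⟨1 / n, w, one_div_pos.2 (by exact_mod_cast hn0), ?_, fun i hi j hj hij => ?_, fun i hi => ?_⟩
  · rw [div_lt_div_iff₀ (by exact_mod_cast hn0) (by norm_num)]
    have : (21 : ℚ) ≤ n := by exact_mod_cast hn'
    linarith
  · have h1 := hn (i, j) (by simp [hi, hj]) hij
    have h2 := (hw i hi).1
    have h3 := (hw j hj).1
    set a : ℂ := (w i).1 + (w i).2 * Complex.I
    set b : ℂ := (w j).1 + (w j).2 * Complex.I
    have h4 : ζ i - ζ j = (a - b) - (a - ζ i) + (b - ζ j) := by ring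
    have h5 := norm_add_le ((a - b) - (a - ζ i)) (b - ζ j)
    have h6 := norm_sub_le (a - b) (a - ζ i)
    rw [← h4] at h5
    have h7 : 22 / (n : ℝ) = 22 * (1 / n) := by ring
    push_cast
    linarith
  · simpa using (hw i hi).2

/-! ### Computability of the number of roots on the unit circle -/

/-- A complex number with rational real and imaginary parts. -/
abbrev ComplexCode := RatCode × RatCode

namespace ComplexCode

/-- The complex number with a given code. -/
noncomputable def val (z : ComplexCode) : ℂ := (RatCode.val z.1 : ℂ) + RatCode.val z.2 * Complex.I

/-- Addition of codes of complex numbers. -/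
def add (z w : ComplexCode) : ComplexCode := (RatCode.add z.1 w.1, RatCode.add z.2 w.2)

/-- Multiplication of codes of complex numbers. -/
def mul (z w : ComplexCode) : ComplexCode :=
  (RatCode.add (RatCode.mul z.1 w.1) (RatCode.neg (RatCode.mul z.2 w.2)),
    RatCode.add (RatCode.mul z.1 w.2) (RatCode.mul z.2 w.1))

/-- Negation of codes of complex numbers. -/
def neg (z : ComplexCode) : ComplexCode := (RatCode.neg z.1, RatCode.neg z.2)

/-- The square of the absolute value. -/
def normSq (z : ComplexCode) : RatCode := RatCode.add (RatCode.mul z.1 z.1) (RatCode.mul z.2 z.2)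

/-- The value of a polynomial at a complex number. -/
def eval (z : ComplexCode) (f : PolyCode) : ComplexCode :=
  f.foldr (fun c w => add (c, (0, 0, 0)) (mul z w)) ((0, 0, 0), (0, 0, 0))

@[simp] theorem val_add (z w : ComplexCode) : val (add z w) = val z + val w := by
  simp only [val, add, RatCode.val_add]
  push_cast
  ring

@[simp] theorem val_mul (z w : ComplexCode) : val (mul z w) = val z * val w := by
  simp only [val, mul, RatCode.val_add, RatCode.val_mul, RatCode.val_neg]
  push_cast
  linear_combination (-(RatCode.val z.2 : ℂ) * RatCode.val w.2) * Complex.I_sq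

@[simp] theorem val_neg (z : ComplexCode) : val (neg z) = -val z := by
  simp only [val, neg, RatCode.val_neg]
  push_cast
  ring

theorem val_normSq (z : ComplexCode) : (RatCode.val (normSq z) : ℝ) = ‖val z‖ ^ 2 := by
  rw [← Complex.normSq_eq_norm_sq, val, normSq, RatCode.val_add, RatCode.val_mul, RatCode.val_mul]
  have := Complex.normSq_add_mul_I (RatCode.val z.1 : ℝ) (RatCode.val z.2 : ℝ)
  push_cast at this ⊢
  rw [this]
  ring

theorem val_eval (z : ComplexCode) (f : PolyCode) :
    val (eval z f) = aeval (val z) (PolyCode.val f) := by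
  induction f with
  | nil => simp [eval, val, PolyCode.val]
  | cons c f ih =>
    rw [eval, List.foldr_cons, ← eval, val_add, val_mul, ih, PolyCode.val]
    simp [val]

theorem exists_val_eq (q : ℚ × ℚ) : ∃ z : ComplexCode, val z = (q.1 : ℂ) + q.2 * Complex.I := by
  obtain ⟨a, ha⟩ := RatCode.val_surjective q.1
  obtain ⟨b, hb⟩ := RatCode.val_surjective q.2
  exact ⟨(a, b), by rw [val, ha, hb]⟩

theorem primrec_add : Primrec₂ add :=
  (RatCode.primrec_add.comp (Primrec.fst.comp Primrec.fst) (Primrec.fst.comp Primrec.snd)).pair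
    (RatCode.primrec_add.comp (Primrec.snd.comp Primrec.fst) (Primrec.snd.comp Primrec.snd))

theorem primrec_mul : Primrec₂ mul := by
  have h1 : Primrec fun x : ComplexCode × ComplexCode => x.1.1 := Primrec.fst.comp Primrec.fst
  have h2 : Primrec fun x : ComplexCode × ComplexCode => x.1.2 := Primrec.snd.comp Primrec.fst
  have h3 : Primrec fun x : ComplexCode × ComplexCode => x.2.1 := Primrec.fst.comp Primrec.snd
  have h4 : Primrec fun x : ComplexCode × ComplexCode => x.2.2 := Primrec.snd.comp Primrec.snd
  exact (RatCode.primrec_add.comp (RatCode.primrec_mul.comp h1 h3)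
    (RatCode.primrec_neg.comp (RatCode.primrec_mul.comp h2 h4))).pair
    (RatCode.primrec_add.comp (RatCode.primrec_mul.comp h1 h4) (RatCode.primrec_mul.comp h2 h3))

theorem primrec_neg : Primrec neg :=
  (RatCode.primrec_neg.comp Primrec.fst).pair (RatCode.primrec_neg.comp Primrec.snd)

theorem primrec_normSq : Primrec normSq :=
  RatCode.primrec_add.comp (RatCode.primrec_mul.comp Primrec.fst Primrec.fst)
    (RatCode.primrec_mul.comp Primrec.snd Primrec.snd)

theorem primrec_eval : Primrec₂ eval := by
  have h : Primrec₂ fun (x : ComplexCode × PolyCode) (y : RatCode × ComplexCode) =>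
      add (y.1, (0, 0, 0)) (mul x.1 y.2) :=
    primrec_add.comp ((Primrec.fst.comp Primrec.snd).pair (Primrec.const _))
      (primrec_mul.comp (Primrec.fst.comp Primrec.fst) (Primrec.snd.comp Primrec.snd))
  exact (Primrec.list_foldr Primrec.snd (Primrec.const ((0, 0, 0), (0, 0, 0))) h :)

end ComplexCode

/-- Subtraction of codes of rational numbers. -/
def RatCode.sub (c d : RatCode) : RatCode := RatCode.add c (RatCode.neg d)

@[simp] theorem RatCode.val_sub (c d : RatCode) :
    RatCode.val (RatCode.sub c d) = RatCode.val c - RatCode.val d := by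
  rw [RatCode.sub, RatCode.val_add, RatCode.val_neg, sub_eq_add_neg]

theorem RatCode.primrec_sub : Primrec₂ RatCode.sub :=
  RatCode.primrec_add.comp Primrec.fst (RatCode.primrec_neg.comp Primrec.snd)

/-- Powers of codes of rational numbers. -/
def RatCode.pow (c : RatCode) (k : ℕ) : RatCode :=
  (List.range k).foldr (fun _ d => RatCode.mul c d) (1, 0, 0)

@[simp] theorem RatCode.val_pow (c : RatCode) (k : ℕ) :
    RatCode.val (RatCode.pow c k) = RatCode.val c ^ k := by
  have (l : List ℕ) : RatCode.val (l.foldr (fun _ d => RatCode.mul c d) (1, 0, 0)) =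
      RatCode.val c ^ l.length := by
    induction l with
    | nil => simp
    | cons i l ih => rw [List.foldr_cons, RatCode.val_mul, ih, List.length_cons, pow_succ']
  rw [RatCode.pow, this, List.length_range]

theorem RatCode.primrec_pow : Primrec₂ RatCode.pow := by
  have h : Primrec₂ fun (x : RatCode × ℕ) (y : ℕ × RatCode) => RatCode.mul x.1 y.2 :=
    RatCode.primrec_mul.comp (Primrec.fst.comp Primrec.fst) (Primrec.snd.comp Primrec.snd)
  exact Primrec.list_foldr (Primrec.list_range.comp Primrec.snd) (Primrec.const _) h

/-- The monic polynomial with given lower coefficients. -/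
def monicCode (c : PolyCode) : PolyCode := c ++ [(1, 0, 0)]

theorem primrec_monicCode : Primrec monicCode := Primrec.list_concat.comp Primrec.id (Primrec.const _)

theorem isTrimmed_one (c : PolyCode) : IsTrimmed c (1, 0, 0) := .inl (by simp)

theorem natDegree_val_monicCode (c : PolyCode) :
    (PolyCode.val (monicCode c)).natDegree = c.length := (isTrimmed_one c).natDegree_val

theorem monic_val_monicCode (c : PolyCode) : (PolyCode.val (monicCode c)).Monic := by
  rw [Monic, monicCode, (isTrimmed_one c).leadingCoeff_val, RatCode.val_one]

theorem exists_monicCode {s : ℚ[X]} (hs : s.Monic) :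
    ∃ c : PolyCode, PolyCode.val (monicCode c) = s := by
  obtain ⟨c, a, h, hc, ha⟩ := PolyCode.exists_val_append_singleton s le_rfl
  refine ⟨c, ?_⟩
  rw [← h, monicCode, PolyCode.val_append_singleton, PolyCode.val_append_singleton, ha,
    coeff_natDegree, hs.leadingCoeff, RatCode.val_one]

open ComplexCode in
/-- The discs of radius `δ` around the points `w` isolate the roots of a monic polynomial. -/
def IsIsolating (c : PolyCode) (δ : RatCode) (w : List ComplexCode) : Prop :=
  (0 < RatCode.val δ ∧ 0 < RatCode.val (RatCode.sub (1, 0, 0) (RatCode.mul (20, 0, 0) δ))) ∧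
  (∀ i ∈ List.range c.length, ∀ j ∈ List.range c.length, i = j ∨
    0 < RatCode.val (RatCode.sub
      (normSq (add (w.getD i ((0, 0, 0), (0, 0, 0))) (neg (w.getD j ((0, 0, 0), (0, 0, 0))))))
      (RatCode.mul (400, 0, 0) (RatCode.mul δ δ)))) ∧
  ∀ i ∈ List.range c.length, 0 < RatCode.val (RatCode.sub
    (RatCode.pow (RatCode.mul δ δ) c.length)
    (normSq (eval (w.getD i ((0, 0, 0), (0, 0, 0))) (monicCode c))))

/-- The disc of radius `δ` around `w` is far away from the unit circle. -/
def IsFar (δ : RatCode) (w : ComplexCode) : Prop :=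
  0 < RatCode.val (RatCode.sub (RatCode.pow (RatCode.sub (ComplexCode.normSq w) (1, 0, 0)) 2)
    (RatCode.mul (9, 0, 0) (RatCode.mul δ δ)))

instance (δ : RatCode) (w : ComplexCode) : Decidable (IsFar δ w) :=
  decidable_of_iff _ (RatCode.val_pos_iff _).symm

/-- The number of discs of radius `δ` that are near the unit circle. -/
def nearCount (d : ℕ) (δ : RatCode) (w : List ComplexCode) : ℕ :=
  (List.range d).foldr (fun i m => if IsFar δ (w.getD i ((0, 0, 0), (0, 0, 0))) then m else m + 1) 0

theorem nearCount_eq_countP (d : ℕ) (δ : RatCode) (w : List ComplexCode) :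
    nearCount d δ w =
      (List.range d).countP fun i => ¬ IsFar δ (w.getD i ((0, 0, 0), (0, 0, 0))) := by
  rw [nearCount]
  induction List.range d with
  | nil => rfl
  | cons i l ih =>
    rw [List.foldr_cons, ih, List.countP_cons]
    by_cases h : IsFar δ (w.getD i ((0, 0, 0), (0, 0, 0)))
    · rw [if_pos h, if_neg (by simpa using h), add_zero]
    · rw [if_neg h, if_pos (by simpa using h)]

theorem primrecRel_isFar : PrimrecRel IsFar := by
  have hδ : Primrec fun x : RatCode × ComplexCode => x.1 := Primrec.fst
  exact RatCode.primrecPred_pos.comp (RatCode.primrec_sub.comp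
    (RatCode.primrec_pow.comp (RatCode.primrec_sub.comp
      (ComplexCode.primrec_normSq.comp Primrec.snd) (Primrec.const _)) (Primrec.const 2))
    (RatCode.primrec_mul.comp (Primrec.const _) (RatCode.primrec_mul.comp hδ hδ)))

theorem primrec_nearCount :
    Primrec fun x : ℕ × RatCode × List ComplexCode => nearCount x.1 x.2.1 x.2.2 := by
  let T := (ℕ × RatCode × List ComplexCode) × (ℕ × ℕ)
  have hδ : Primrec fun x : T => x.1.2.1 := Primrec.fst.comp (Primrec.snd.comp Primrec.fst)
  have hw : Primrec fun x : T => x.1.2.2.getD x.2.1 ((0, 0, 0), (0, 0, 0)) :=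
    (Primrec.list_getD _).comp (Primrec.snd.comp (Primrec.snd.comp Primrec.fst))
      (Primrec.fst.comp Primrec.snd)
  have hm : Primrec fun x : T => x.2.2 := Primrec.snd.comp Primrec.snd
  have h : Primrec₂ fun (x : ℕ × RatCode × List ComplexCode) (y : ℕ × ℕ) =>
      if IsFar x.2.1 (x.2.2.getD y.1 ((0, 0, 0), (0, 0, 0))) then y.2 else y.2 + 1 :=
    Primrec.ite (primrecRel_isFar.comp hδ hw) hm (Primrec.succ.comp hm)
  exact (Primrec.list_foldr (Primrec.list_range.comp Primrec.fst) (Primrec.const 0) h :)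

theorem semidecidable_isIsolating :
    Semidecidable fun x : PolyCode × RatCode × List ComplexCode => IsIsolating x.1 x.2.1 x.2.2 := by
  let T := PolyCode × RatCode × List ComplexCode
  have hc : Primrec fun x : T => x.1 := Primrec.fst
  have hδ : Primrec fun x : T => x.2.1 := Primrec.fst.comp Primrec.snd
  have hδδ : Primrec fun x : T => RatCode.mul x.2.1 x.2.1 := RatCode.primrec_mul.comp hδ hδ
  have hw : Primrec₂ fun (x : T) (i : ℕ) => x.2.2.getD i ((0, 0, 0), (0, 0, 0)) :=
    (Primrec.list_getD _).comp (Primrec.snd.comp (Primrec.snd.comp Primrec.fst)) Primrec.snd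
  have hr : Primrec fun x : T => List.range x.1.length :=
    Primrec.list_range.comp (Primrec.list_length.comp hc)
  have h1 : PrimrecPred fun x : T => 0 < RatCode.val x.2.1 := RatCode.primrecPred_pos.comp hδ
  have h2 : PrimrecPred fun x : T =>
      0 < RatCode.val (RatCode.sub (1, 0, 0) (RatCode.mul (20, 0, 0) x.2.1)) :=
    RatCode.primrecPred_pos.comp (RatCode.primrec_sub.comp (Primrec.const _)
      (RatCode.primrec_mul.comp (Primrec.const _) hδ))
  have hij : Primrec fun y : (T × ℕ) × ℕ => ComplexCode.add
      (y.1.1.2.2.getD y.1.2 ((0, 0, 0), (0, 0, 0)))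
      (ComplexCode.neg (y.1.1.2.2.getD y.2 ((0, 0, 0), (0, 0, 0)))) :=
    ComplexCode.primrec_add.comp
      (hw.comp (Primrec.fst.comp Primrec.fst) (Primrec.snd.comp Primrec.fst))
      (ComplexCode.primrec_neg.comp (hw.comp (Primrec.fst.comp Primrec.fst) Primrec.snd))
  have h3 : PrimrecPred fun y : (T × ℕ) × ℕ => y.1.2 = y.2 ∨ 0 < RatCode.val (RatCode.sub
      (ComplexCode.normSq (ComplexCode.add (y.1.1.2.2.getD y.1.2 ((0, 0, 0), (0, 0, 0)))
        (ComplexCode.neg (y.1.1.2.2.getD y.2 ((0, 0, 0), (0, 0, 0))))))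
      (RatCode.mul (400, 0, 0) (RatCode.mul y.1.1.2.1 y.1.1.2.1))) :=
    PrimrecPred.or (Primrec.eq.comp (Primrec.snd.comp Primrec.fst) Primrec.snd)
      (RatCode.primrecPred_pos.comp (RatCode.primrec_sub.comp
        (ComplexCode.primrec_normSq.comp hij)
        (RatCode.primrec_mul.comp (Primrec.const _)
          (hδδ.comp (Primrec.fst.comp Primrec.fst)))))
  have h4 := (h3.semidecidable.forall_mem_comp (hr.comp Primrec.fst)).forall_mem_comp hr
  have hpow : Primrec fun x : T => RatCode.pow (RatCode.mul x.2.1 x.2.1) x.1.length :=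
    RatCode.primrec_pow.comp hδδ (Primrec.list_length.comp hc)
  have heval : Primrec fun y : T × ℕ => ComplexCode.eval
      (y.1.2.2.getD y.2 ((0, 0, 0), (0, 0, 0))) (monicCode y.1.1) :=
    ComplexCode.primrec_eval.comp (hw.comp Primrec.fst Primrec.snd)
      (primrec_monicCode.comp (hc.comp Primrec.fst))
  have h5 : PrimrecPred fun y : T × ℕ => 0 < RatCode.val (RatCode.sub
      (RatCode.pow (RatCode.mul y.1.2.1 y.1.2.1) y.1.1.length)
      (ComplexCode.normSq (ComplexCode.eval
        (y.1.2.2.getD y.2 ((0, 0, 0), (0, 0, 0))) (monicCode y.1.1)))) :=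
    RatCode.primrecPred_pos.comp (RatCode.primrec_sub.comp (hpow.comp Primrec.fst)
      (ComplexCode.primrec_normSq.comp heval))
  exact (h1.and h2).semidecidable.and (h4.and (h5.semidecidable.forall_mem_comp hr))

theorem isFar_iff (δ : RatCode) (w : ComplexCode) :
    ¬ IsFar δ w ↔ (‖w.val‖ ^ 2 - 1) ^ 2 ≤ 9 * (RatCode.val δ : ℝ) ^ 2 := by
  have h9 : RatCode.val (9, 0, 0) = 9 := RatCode.val_natCast 9
  rw [IsFar, not_lt, RatCode.val_sub, RatCode.val_pow, RatCode.val_sub, RatCode.val_mul,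
    RatCode.val_mul, RatCode.val_one, sub_nonpos, ← ComplexCode.val_normSq, h9, ← sq]
  norm_cast

/-- The code compares squares, so that only rational arithmetic occurs: `400 = 20²`, and `(δ²) ^ d`
is the square of `δ ^ d`. -/
theorem isIsolating_iff (c : PolyCode) (δ : RatCode) (w : List ComplexCode) :
    IsIsolating c δ w ↔ (0 < RatCode.val δ ∧ RatCode.val δ < 1 / 20) ∧
      (∀ i < c.length, ∀ j < c.length, i ≠ j → 20 * (RatCode.val δ : ℝ) <
        ‖(w.getD i ((0, 0, 0), (0, 0, 0))).val - (w.getD j ((0, 0, 0), (0, 0, 0))).val‖) ∧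
      ∀ i < c.length, ‖((PolyCode.val (monicCode c)).map (algebraMap ℚ ℂ)).eval
        (w.getD i ((0, 0, 0), (0, 0, 0))).val‖ < (RatCode.val δ : ℝ) ^ c.length := by
  have h20 : RatCode.val (20, 0, 0) = 20 := RatCode.val_natCast 20
  have h400 : RatCode.val (400, 0, 0) = 400 := RatCode.val_natCast 400
  have hcast (x y : RatCode) :
      0 < RatCode.val (RatCode.sub x y) ↔ (RatCode.val y : ℝ) < (RatCode.val x : ℝ) := by
    rw [RatCode.val_sub, sub_pos, Rat.cast_lt]
  -- Undoing the squares needs `δ ≥ 0`; for `δ ≤ 0` both sides are false.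
  by_cases hδ : 0 < RatCode.val δ
  swap
  · simp [IsIsolating, hδ]
  have hδ0 : (0 : ℝ) ≤ (RatCode.val δ : ℝ) := by exact_mod_cast hδ.le
  have h1 : 0 < RatCode.val (RatCode.sub (1, 0, 0) (RatCode.mul (20, 0, 0) δ)) ↔
      RatCode.val δ < 1 / 20 := by
    rw [RatCode.val_sub, RatCode.val_mul, RatCode.val_one, h20]
    constructor <;> intro h <;> linarith
  have h2 (z : ComplexCode) : 0 < RatCode.val (RatCode.sub (ComplexCode.normSq z)
      (RatCode.mul (400, 0, 0) (RatCode.mul δ δ))) ↔ 20 * (RatCode.val δ : ℝ) < ‖z.val‖ := by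
    rw [hcast, ComplexCode.val_normSq, RatCode.val_mul, RatCode.val_mul, h400,
      ← pow_lt_pow_iff_left₀ (by positivity) (norm_nonneg _) two_ne_zero]
    push_cast
    ring_nf
  have h3 (z : ComplexCode) : 0 < RatCode.val (RatCode.sub
      (RatCode.pow (RatCode.mul δ δ) c.length) (ComplexCode.normSq z)) ↔
        ‖z.val‖ < (RatCode.val δ : ℝ) ^ c.length := by
    rw [hcast, ComplexCode.val_normSq, RatCode.val_pow, RatCode.val_mul, ← sq,
      ← pow_lt_pow_iff_left₀ (norm_nonneg _) (by positivity) two_ne_zero, ← pow_mul, mul_comm 2,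
      pow_mul]
    push_cast
    rfl
  simp only [IsIsolating, hδ, h1, h2, h3, List.mem_range, ComplexCode.val_add,
    ComplexCode.val_neg, ComplexCode.val_eval, ← sub_eq_add_neg, eval_map_algebraMap,
    or_iff_not_imp_left, ne_eq]

/-! ### Counting the roots on the unit circle -/

theorem unitCircleRootCount_eq_countP (r : ℚ[X]) (p : ℂ → Prop) [DecidablePred p]
    (hp : ∀ ζ, p ζ ↔ ‖ζ‖ = 1) :
    unitCircleRootCount r = (r.map (algebraMap ℚ ℂ)).roots.countP p := by
  rw [unitCircleRootCount, ← Multiset.countP_eq_card_filter]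
  exact Multiset.countP_congr rfl fun ζ _ => propext (hp ζ).symm

theorem unitCircleRootCount_mul {p q : ℚ[X]} (hpq : p * q ≠ 0) :
    unitCircleRootCount (p * q) = unitCircleRootCount p + unitCircleRootCount q := by
  classical
  have h : (p * q).map (algebraMap ℚ ℂ) ≠ 0 := Polynomial.map_ne_zero hpq
  rw [Polynomial.map_mul] at h
  simp only [unitCircleRootCount_eq_countP _ (fun ζ : ℂ => ‖ζ‖ = 1) fun _ => Iff.rfl]
  rw [Polynomial.map_mul, roots_mul h, Multiset.countP_add]

theorem unitCircleRootCount_C (c : ℚ) : unitCircleRootCount (C c) = 0 := by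
  simp [unitCircleRootCount]

theorem unitCircleRootCount_one : unitCircleRootCount 1 = 0 := unitCircleRootCount_C 1

theorem aeval_conj_eq_zero {s : ℚ[X]} {ζ : ℂ} (h : aeval ζ s = 0) :
    aeval (starRingEnd ℂ ζ) s = 0 := by
  have := aeval_algHom_apply ((Complex.conjAe : ℂ →ₐ[ℝ] ℂ).restrictScalars ℚ) ζ s
  rw [h, map_zero] at this
  exact this

/-- A root on the unit circle has its conjugate as inverse, and the conjugate is a root because the
coefficients are rational. -/
theorem unitCircleRootCount_eq_zero {s : ℚ[X]}
    (h : ∀ x y : ℂ, x * y = 1 → aeval x s = 0 → aeval y s ≠ 0) : unitCircleRootCount s = 0 := by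
  classical
  rw [unitCircleRootCount_eq_countP _ (fun ζ : ℂ => ‖ζ‖ = 1) fun _ => Iff.rfl,
    Multiset.countP_eq_zero]
  intro ζ hζ h1
  have h0 : aeval ζ s = 0 := by
    rw [← eval_map_algebraMap]
    exact isRoot_of_mem_roots hζ
  refine h ζ (starRingEnd ℂ ζ) ?_ h0 (aeval_conj_eq_zero h0)
  rw [Complex.mul_conj, Complex.normSq_eq_norm_sq, h1]
  norm_num

theorem unitCircleRootCount_eq_nearCount {c : PolyCode} {δ : RatCode} {w : List ComplexCode}
    (h : ∀ x y : ℂ, x * y = 1 → aeval x (PolyCode.val (monicCode c)) = 0 →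
      aeval y (PolyCode.val (monicCode c)) = 0) (hw : IsIsolating c δ w) :
    unitCircleRootCount (PolyCode.val (monicCode c)) = nearCount c.length δ w := by
  classical
  obtain ⟨⟨hδ, hδ'⟩, hsep, hroot⟩ := (isIsolating_iff c δ w).1 hw
  have hmonic := (monic_val_monicCode c).map (algebraMap ℚ ℂ)
  have hdeg : ((PolyCode.val (monicCode c)).map (algebraMap ℚ ℂ)).natDegree = c.length := by
    rw [natDegree_map, natDegree_val_monicCode]
  have hroots (ζ : ℂ) : ζ ∈ ((PolyCode.val (monicCode c)).map (algebraMap ℚ ℂ)).roots ↔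
      aeval ζ (PolyCode.val (monicCode c)) = 0 := by
    rw [mem_roots hmonic.ne_zero, IsRoot, eval_map_algebraMap]
  rw [unitCircleRootCount_eq_countP _ (fun ζ : ℂ => ‖ζ‖ = 1) fun _ => Iff.rfl,
    nearCount_eq_countP, Multiset.countP_eq_card_filter, ← hdeg]
  rw [← hdeg] at hsep hroot
  refine card_filter_roots_eq_countP hmonic (by exact_mod_cast hδ)
    (by have := (Rat.cast_lt (K := ℝ)).2 hδ'; push_cast at this; exact this) hsep hroot ?_ _
    (fun _ => Iff.rfl) _ fun i => isFar_iff δ _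
  intro ζ hζ h0
  rw [hroots] at hζ ⊢
  have hc : starRingEnd ℂ ζ ≠ 0 := (_root_.map_ne_zero _).2 h0
  exact h _ _ (mul_inv_cancel₀ hc) (aeval_conj_eq_zero hζ)

/-- One pair of mutually inverse roots suffices: `x₀` is then a root of the reversed polynomial,
which is divisible by `s`, the minimal polynomial of `x₀`. So the inverse of every root is a root.
-/
theorem aeval_eq_zero_of_irreducible {s : ℚ[X]} (hs : Irreducible s) (hm : s.Monic) {x₀ y₀ : ℂ}
    (h₀ : x₀ * y₀ = 1) (hx₀ : aeval x₀ s = 0) (hy₀ : aeval y₀ s = 0) {x y : ℂ} (h : x * y = 1)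
    (hx : aeval x s = 0) : aeval y s = 0 := by
  have hrev {x y : ℂ} (h : x * y = 1) : aeval x s.reverse = 0 ↔ aeval y s = 0 := by
    let : Invertible y := invertibleOfRightInverse y x ((mul_comm y x).trans h)
    exact eval₂_reverse_eq_zero_iff (algebraMap ℚ ℂ) y s
  have hdvd : s ∣ s.reverse := by
    have h1 := minpoly.dvd ℚ x₀ ((hrev h₀).2 hy₀)
    rwa [← minpoly.eq_of_irreducible_of_monic hs hx₀ hm] at h1
  exact (hrev h).1 (aeval_eq_zero_of_dvd_aeval_eq_zero hdvd hx)

theorem exists_isIsolating {c : PolyCode} (hs : (PolyCode.val (monicCode c)).Separable) :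
    ∃ (δ : RatCode) (w : List ComplexCode), IsIsolating c δ w := by
  obtain ⟨δ, w, h1, h2, h3, h4⟩ := exists_isolating_discs
    (nodup_roots (hs.map (f := algebraMap ℚ ℂ)))
  rw [natDegree_map, natDegree_val_monicCode] at h3 h4
  obtain ⟨δ, rfl⟩ := RatCode.val_surjective δ
  choose z hz using fun i => ComplexCode.exists_val_eq (w i)
  have hget (i) (hi : i < c.length) : (((List.range c.length).map z).getD i
      ((0, 0, 0), (0, 0, 0))).val = ((w i).1 + (w i).2 * Complex.I : ℂ) := by
    rw [List.getD_eq_getElem _ _ (by simpa using hi)]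
    simp [hz]
  refine ⟨δ, (List.range c.length).map z, (isIsolating_iff _ _ _).2 ⟨⟨h1, h2⟩, ?_, ?_⟩⟩
  · intro i hi j hj hij
    rw [hget i hi, hget j hj]
    exact h3 i hi j hj hij
  · intro i hi
    rw [hget i hi]
    exact h4 i hi

/-- A certificate that `m` is the number of roots on the unit circle of a monic polynomial:
either no two of its roots are inverse to each other, or the set of roots is closed under
inversion and the roots are isolated. -/
def IsCertifiedCount (c : PolyCode) (m : ℕ) : Prop :=
  (m = 0 ∧ Implies 2 [MvPolyCode.mul (MvPolyCode.var 0) (MvPolyCode.var 1) ++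
      MvPolyCode.const (0, 1, 0), MvPolyCode.subst (monicCode c) (MvPolyCode.var 0),
      MvPolyCode.subst (monicCode c) (MvPolyCode.var 1)] (MvPolyCode.const (1, 0, 0))) ∨
  (Implies 2 [MvPolyCode.mul (MvPolyCode.var 0) (MvPolyCode.var 1) ++
      MvPolyCode.const (0, 1, 0), MvPolyCode.subst (monicCode c) (MvPolyCode.var 0)]
      (MvPolyCode.subst (monicCode c) (MvPolyCode.var 1)) ∧
    ∃ x : RatCode × List ComplexCode, IsIsolating c x.1 x.2 ∧ m = nearCount c.length x.1 x.2)

theorem isCertifiedCount_iff (c : PolyCode) (m : ℕ) : IsCertifiedCount c m ↔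
    (m = 0 ∧ ∀ x y : ℂ, x * y = 1 → aeval x (PolyCode.val (monicCode c)) = 0 →
      aeval y (PolyCode.val (monicCode c)) ≠ 0) ∨
    ((∀ x y : ℂ, x * y = 1 → aeval x (PolyCode.val (monicCode c)) = 0 →
      aeval y (PolyCode.val (monicCode c)) = 0) ∧
      ∃ x : RatCode × List ComplexCode, IsIsolating c x.1 x.2 ∧
        m = nearCount c.length x.1 x.2) := by
  have h0 (x : ℕ → ℂ) : MvPolyCode.ev 2 x (MvPolyCode.var 0) = x 0 :=
    MvPolyCode.ev_var Nat.zero_lt_two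
  have h1 (x : ℕ → ℂ) : MvPolyCode.ev 2 x (MvPolyCode.var 1) = x 1 :=
    MvPolyCode.ev_var Nat.one_lt_two
  have hneg : RatCode.val (0, 1, 0) = -1 := by simp [RatCode.val]
  have hall (P : ℂ → ℂ → Prop) : (∀ x : ℕ → ℂ, P (x 0) (x 1)) ↔ ∀ x y, P x y :=
    ⟨fun h x y => h fun i => if i = 0 then x else y, fun h x => h _ _⟩
  simp only [IsCertifiedCount, Implies, List.forall_mem_cons, MvPolyCode.ev_append,
    MvPolyCode.ev_mul, MvPolyCode.ev_const, MvPolyCode.ev_subst, h0, h1, hneg, RatCode.val_one]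
  simp only [List.not_mem_nil, false_imp_iff, implies_true, and_true, Rat.cast_one, one_ne_zero,
    imp_false, Rat.cast_neg, ← sub_eq_add_neg, sub_eq_zero, not_and, ne_eq, and_imp]
  rw [hall fun x y => x * y = 1 → aeval x (PolyCode.val (monicCode c)) = 0 →
      ¬ aeval y (PolyCode.val (monicCode c)) = 0,
    hall fun x y => x * y = 1 → aeval x (PolyCode.val (monicCode c)) = 0 →
      aeval y (PolyCode.val (monicCode c)) = 0]

theorem IsCertifiedCount.eq_unitCircleRootCount {c : PolyCode} {m : ℕ}
    (h : IsCertifiedCount c m) : m = unitCircleRootCount (PolyCode.val (monicCode c)) := by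
  rcases (isCertifiedCount_iff c m).1 h with ⟨rfl, h'⟩ | ⟨h', x, hx, rfl⟩
  · exact (unitCircleRootCount_eq_zero h').symm
  · exact (unitCircleRootCount_eq_nearCount h' hx).symm

/-- Irreducibility yields the dichotomy between the two kinds of certificate, and separability
supplies the isolating discs in the second. -/
theorem exists_isCertifiedCount {c : PolyCode} (h : Irreducible (PolyCode.val (monicCode c))) :
    ∃ m, IsCertifiedCount c m := by
  simp only [isCertifiedCount_iff]
  by_cases hxy : ∀ x y : ℂ, x * y = 1 → aeval x (PolyCode.val (monicCode c)) = 0 →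
      aeval y (PolyCode.val (monicCode c)) ≠ 0
  · exact ⟨0, .inl ⟨rfl, hxy⟩⟩
  · push Not at hxy
    obtain ⟨x₀, y₀, h₀, hx₀, hy₀⟩ := hxy
    obtain ⟨δ, w, hw⟩ := exists_isIsolating h.separable
    exact ⟨_, .inr ⟨fun x y hxy hx => aeval_eq_zero_of_irreducible h (monic_val_monicCode c) h₀ hx₀
      hy₀ hxy hx, (δ, w), hw, rfl⟩⟩

theorem semidecidable_isCertifiedCount :
    Semidecidable fun x : PolyCode × ℕ => IsCertifiedCount x.1 x.2 := by
  have hs (i : ℕ) : Primrec fun x : PolyCode × ℕ =>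
      MvPolyCode.subst (monicCode x.1) (MvPolyCode.var i) :=
    MvPolyCode.primrec_subst.comp (primrec_monicCode.comp Primrec.fst) (Primrec.const _)
  have h1 : Primrec fun x : PolyCode × ℕ => [MvPolyCode.mul (MvPolyCode.var 0) (MvPolyCode.var 1) ++
      MvPolyCode.const (0, 1, 0), MvPolyCode.subst (monicCode x.1) (MvPolyCode.var 0),
      MvPolyCode.subst (monicCode x.1) (MvPolyCode.var 1)] :=
    Primrec.list_cons.comp (Primrec.const _) (Primrec.list_cons.comp (hs 0)
      (Primrec.list_cons.comp (hs 1) (Primrec.const [])))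
  have h2 : Primrec fun x : PolyCode × ℕ => [MvPolyCode.mul (MvPolyCode.var 0) (MvPolyCode.var 1) ++
      MvPolyCode.const (0, 1, 0), MvPolyCode.subst (monicCode x.1) (MvPolyCode.var 0)] :=
    Primrec.list_cons.comp (Primrec.const _) (Primrec.list_cons.comp (hs 0) (Primrec.const []))
  have hA := semidecidable_implies.comp ((Primrec.const 2).pair
    (h1.pair (Primrec.const (MvPolyCode.const (1, 0, 0)))))
  have hB := semidecidable_implies.comp ((Primrec.const 2).pair (h2.pair (hs 1)))
  have hm : PrimrecPred fun x : PolyCode × ℕ => x.2 = 0 :=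
    Primrec.eq.comp Primrec.snd (Primrec.const 0)
  let T := (PolyCode × ℕ) × (RatCode × List ComplexCode)
  have hc : Primrec fun t : T => t.1.1 := Primrec.fst.comp Primrec.fst
  have hδ : Primrec fun t : T => t.2.1 := Primrec.fst.comp Primrec.snd
  have hw : Primrec fun t : T => t.2.2 := Primrec.snd.comp Primrec.snd
  have hI : Semidecidable fun t : T => IsIsolating t.1.1 t.2.1 t.2.2 :=
    (semidecidable_isIsolating.comp (hc.pair (hδ.pair hw)) :)
  have hn : Primrec fun t : T => nearCount t.1.1.length t.2.1 t.2.2 :=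
    (primrec_nearCount.comp ((Primrec.list_length.comp hc).pair (hδ.pair hw)) :)
  have hN : PrimrecPred fun t : T => t.1.2 = nearCount t.1.1.length t.2.1 t.2.2 :=
    Primrec.eq.comp (Primrec.snd.comp Primrec.fst) hn
  exact (hm.semidecidable.and hA).or (hB.and (hI.and hN.semidecidable).exists)

/-- A factorization of a polynomial into a constant and monic polynomials, each together with
a certified number of roots on the unit circle. -/
def IsCertifiedFactorization (r : PolyCode) (a : RatCode) (l : List (PolyCode × ℕ)) : Prop :=
  MvPolyCode.val 1 (MvPolyCode.subst r (MvPolyCode.var 0) ++ MvPolyCode.neg (MvPolyCode.mul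
    (MvPolyCode.const a) (MvPolyCode.prod (l.map fun y =>
      MvPolyCode.subst (monicCode y.1) (MvPolyCode.var 0))))) = 0 ∧
  ∀ y ∈ l, IsCertifiedCount y.1 y.2

theorem isCertifiedFactorization_iff (r : PolyCode) (a : RatCode) (l : List (PolyCode × ℕ)) :
    IsCertifiedFactorization r a l ↔ PolyCode.val r = C (RatCode.val a) *
      (l.map fun y => PolyCode.val (monicCode y.1)).prod ∧ ∀ y ∈ l, IsCertifiedCount y.1 y.2 := by
  refine and_congr ?_ Iff.rfl
  have hX : MvPolyCode.val 1 (MvPolyCode.var 0) = MvPolynomial.X 0 := MvPolyCode.val_var (0 : Fin 1)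
  have hprod : MvPolyCode.val 1 (MvPolyCode.mul (MvPolyCode.const a) (MvPolyCode.prod
      (l.map fun y => MvPolyCode.subst (monicCode y.1) (MvPolyCode.var 0)))) =
      aeval (MvPolynomial.X 0) (C (RatCode.val a) *
        (l.map fun y => PolyCode.val (monicCode y.1)).prod) := by
    rw [MvPolyCode.val_mul, MvPolyCode.val_const, MvPolyCode.val_prod, map_mul, aeval_C,
      map_list_prod, List.map_map, List.map_map]
    simp only [Function.comp_def, MvPolyCode.val_subst, hX]
    rfl
  rw [MvPolyCode.val_append, MvPolyCode.val_neg, add_neg_eq_zero, hprod, MvPolyCode.val_subst, hX]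
  refine ⟨fun h => ?_, fun h => by rw [h]⟩
  have := congrArg (MvPolynomial.aeval fun _ => (X : ℚ[X])) h
  rw [← aeval_algHom_apply, ← aeval_algHom_apply, MvPolynomial.aeval_X, aeval_X_left_apply,
    aeval_X_left_apply] at this
  exact this

/-- Counting with multiplicity is additive over products. The factors need not be irreducible for
this; irreducibility only guarantees that certificates exist. -/
theorem IsCertifiedFactorization.sum_eq {r : PolyCode} {a : RatCode} {l : List (PolyCode × ℕ)}
    (h : IsCertifiedFactorization r a l) (hr : PolyCode.val r ≠ 0) :
    (l.map Prod.snd).sum = unitCircleRootCount (PolyCode.val r) := by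
  obtain ⟨h, hl⟩ := (isCertifiedFactorization_iff r a l).1 h
  have key (l : List (PolyCode × ℕ)) (hl : ∀ y ∈ l, IsCertifiedCount y.1 y.2) :
      (l.map fun y => PolyCode.val (monicCode y.1)).prod ≠ 0 ∧ (l.map Prod.snd).sum =
        unitCircleRootCount (l.map fun y => PolyCode.val (monicCode y.1)).prod := by
    induction l with
    | nil => simp [unitCircleRootCount_one]
    | cons y l ih =>
      obtain ⟨h0, ih⟩ := ih fun z hz => hl z (List.mem_cons_of_mem _ hz)
      have h1 : PolyCode.val (monicCode y.1) *
          (l.map fun y => PolyCode.val (monicCode y.1)).prod ≠ 0 :=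
        mul_ne_zero (monic_val_monicCode y.1).ne_zero h0
      rw [List.map_cons, List.map_cons, List.prod_cons, List.sum_cons, unitCircleRootCount_mul h1,
        ih, ← (hl y List.mem_cons_self).eq_unitCircleRootCount]
      exact ⟨h1, rfl⟩
  rw [(key l hl).2]
  rw [h] at hr ⊢
  rw [unitCircleRootCount_mul hr, unitCircleRootCount_C, zero_add]

theorem exists_isCertifiedFactorization (r : PolyCode) :
    ∃ a l, IsCertifiedFactorization r a l := by
  simp only [isCertifiedFactorization_iff]
  generalize PolyCode.val r = r
  induction r using WfDvdMonoid.induction_on_irreducible with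
  -- The zero polynomial gets a certificate too, so that the search is total; its count has no
  -- meaning.
  | zero => exact ⟨(0, 0, 0), [], by simp, by simp⟩
  | unit u hu =>
    obtain ⟨c, -, rfl⟩ := isUnit_iff.1 hu
    obtain ⟨a, rfl⟩ := RatCode.val_surjective c
    exact ⟨a, [], by simp, by simp⟩
  | mul r s hr hs ih =>
    obtain ⟨a, l, h, hl⟩ := ih
    have h0 : s.leadingCoeff ≠ 0 := leadingCoeff_ne_zero.2 hs.ne_zero
    obtain ⟨c, hc⟩ := exists_monicCode (monic_mul_leadingCoeff_inv hs.ne_zero)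
    have hirr : Irreducible (PolyCode.val (monicCode c)) := by
      rw [hc]
      exact (irreducible_mul_leadingCoeff_inv).2 hs
    obtain ⟨m, hm⟩ := exists_isCertifiedCount hirr
    obtain ⟨b, hb⟩ := RatCode.val_surjective s.leadingCoeff
    refine ⟨RatCode.mul b a, (c, m) :: l, ?_, ?_⟩
    · have hs' : s = C s.leadingCoeff * (s * C s.leadingCoeff⁻¹) := by
        rw [mul_left_comm, ← C_mul, mul_inv_cancel₀ h0, C_1, mul_one]
      rw [List.map_cons, List.prod_cons, hc, RatCode.val_mul, C_mul, hb, h]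
      conv_lhs => rw [hs']
      ring
    · exact List.forall_mem_cons.2 ⟨hm, hl⟩

theorem semidecidable_isCertifiedFactorization :
    Semidecidable fun x : PolyCode × RatCode × List (PolyCode × ℕ) =>
      IsCertifiedFactorization x.1 x.2.1 x.2.2 := by
  let T := PolyCode × RatCode × List (PolyCode × ℕ)
  have hr : Primrec fun t : T => t.1 := Primrec.fst
  have ha : Primrec fun t : T => t.2.1 := Primrec.fst.comp Primrec.snd
  have hl : Primrec fun t : T => t.2.2 := Primrec.snd.comp Primrec.snd
  have hy : Primrec₂ fun (_ : T) (y : PolyCode × ℕ) =>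
      MvPolyCode.subst (monicCode y.1) (MvPolyCode.var 0) :=
    MvPolyCode.primrec_subst.comp (primrec_monicCode.comp (Primrec.fst.comp Primrec.snd))
      (Primrec.const _)
  have hp : Primrec fun t : T => MvPolyCode.subst t.1 (MvPolyCode.var 0) ++
      MvPolyCode.neg (MvPolyCode.mul (MvPolyCode.const t.2.1) (MvPolyCode.prod
        (t.2.2.map fun y => MvPolyCode.subst (monicCode y.1) (MvPolyCode.var 0)))) :=
    Primrec.list_append.comp (MvPolyCode.primrec_subst.comp hr (Primrec.const _))
      (MvPolyCode.primrec_neg.comp (MvPolyCode.primrec_mul.comp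
        (MvPolyCode.primrec_const.comp ha)
        (MvPolyCode.primrec_prod.comp (Primrec.list_map hl hy))))
  have h1 : PrimrecPred fun t : T => MvPolyCode.val 1 (MvPolyCode.subst t.1 (MvPolyCode.var 0) ++
      MvPolyCode.neg (MvPolyCode.mul (MvPolyCode.const t.2.1) (MvPolyCode.prod
        (t.2.2.map fun y => MvPolyCode.subst (monicCode y.1) (MvPolyCode.var 0))))) = 0 :=
    MvPolyCode.primrecRel_val_eq_zero.comp (Primrec.const 1) hp
  have hs : Primrec fun x : T × (PolyCode × ℕ) => x.2 := Primrec.snd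
  have h2 : Semidecidable fun x : T × (PolyCode × ℕ) => IsCertifiedCount x.2.1 x.2.2 :=
    semidecidable_isCertifiedCount.comp hs
  exact h1.semidecidable.and (h2.forall_mem_comp hl)

theorem exists_computable_unitCircleRootCount : ∃ count : PolyCode → ℕ, Computable count ∧
    ∀ r : PolyCode, PolyCode.val r ≠ 0 → count r = unitCircleRootCount (PolyCode.val r) := by
  obtain ⟨F, hF, h⟩ := semidecidable_isCertifiedFactorization.exists_computable fun r =>
    let ⟨a, l, h⟩ := exists_isCertifiedFactorization r
    ⟨(a, l), h⟩
  have hsum : Primrec fun l : List (PolyCode × ℕ) => (l.map Prod.snd).sum := by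
    let T := List (PolyCode × ℕ) × ((PolyCode × ℕ) × ℕ)
    have h1 : Primrec fun z : T => z.2.1.2 :=
      have h0 : Primrec fun z : T => z.2.1 := Primrec.fst.comp Primrec.snd
      Primrec.snd.comp h0
    have h2 : Primrec fun z : T => z.2.2 := Primrec.snd.comp Primrec.snd
    have h3 : Primrec₂ fun (_ : List (PolyCode × ℕ)) (x : (PolyCode × ℕ) × ℕ) => x.1.2 + x.2 :=
      Primrec.nat_add.comp h1 h2
    have h4 : Primrec fun l : List (PolyCode × ℕ) => l := Primrec.id
    refine (Primrec.list_foldr h4 (Primrec.const (0 : ℕ)) h3).of_eq fun l => ?_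
    induction l with
    | nil => rfl
    | cons y l ih => rw [List.map_cons, List.sum_cons, ← ih]; rfl
  exact ⟨fun r => ((F r).2.map Prod.snd).sum, hsum.to_comp.comp (Computable.snd.comp hF),
    fun r hr => (h r).sum_eq hr⟩

end UnitCircleCount

/-! ### Composition of the three procedures, and correctness of the method. -/

theorem mainTheorem4 :
    -- `l_k` is computable, by the stated method, from generators of the ideal
    (∃ (l : UnitCircleCount.IdealCode × ℕ →. ℕ)
        (univRep : UnitCircleCount.IdealCode →. UnitCircleCount.URCode)
        (res : UnitCircleCount.URCode × ℕ → UnitCircleCount.PolyCode)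
        (count : UnitCircleCount.PolyCode → ℕ),
      Partrec l ∧ Partrec univRep ∧ Computable res ∧ Computable count ∧
      -- `l` finds a univariate representation, computes a resultant, and counts its roots
      (∀ (s : UnitCircleCount.IdealCode) (k : ℕ),
        l (s, k) = (univRep s).map fun u => count (res (u, k))) ∧
      (∀ (u : UnitCircleCount.URCode) (k : ℕ),
        UnitCircleCount.PolyCode.val (res (u, k)) =
          UnitCircleCount.elimResultant (UnitCircleCount.URCode.f u)
            (UnitCircleCount.URCode.g u k)) ∧
      (∀ r : UnitCircleCount.PolyCode, UnitCircleCount.PolyCode.val r ≠ 0 →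
        count r = UnitCircleCount.unitCircleRootCount (UnitCircleCount.PolyCode.val r)) ∧
      (∀ (n : ℕ) (ps : List UnitCircleCount.MvPolyCode),
        UnitCircleCount.IsZeroDimensional (UnitCircleCount.idealOf n ps) →
        (∃ u ∈ univRep (n, ps),
          UnitCircleCount.IsUnivariateRepresentation (UnitCircleCount.idealOf n ps)
            (fun i : Fin n => UnitCircleCount.URCode.a u i) (UnitCircleCount.URCode.f u)
            (fun i : Fin n => UnitCircleCount.URCode.g u i) ∧
          Squarefree (UnitCircleCount.URCode.f u)) ∧
        ∀ k : Fin n, l ((n, ps), (k : ℕ)) =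
          Part.some (UnitCircleCount.unitCount (UnitCircleCount.idealOf n ps) k))) ∧
    -- the method is correct for every univariate representation with squarefree `f`
    (∀ (n : ℕ) (I : Ideal (MvPolynomial (Fin n) ℚ))
        (hI : UnitCircleCount.IsZeroDimensional I)
        (a : Fin n → ℚ) (f : Polynomial ℚ) (g : Fin n → Polynomial ℚ),
      UnitCircleCount.IsUnivariateRepresentation I a f g → Squarefree f →
      ∀ k : Fin n,
        (∃ c : ℂ, c ≠ 0 ∧
          (UnitCircleCount.elimResultant f (g k)).map (algebraMap ℚ ℂ) =
            Polynomial.C c *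
              ∏ α ∈ Set.Finite.toFinset hI, (Polynomial.X - Polynomial.C (α k))) ∧
        (∀ w : ℂ,
          ((UnitCircleCount.elimResultant f (g k)).map (algebraMap ℚ ℂ)).rootMultiplicity w =
            {z | z ∈ UnitCircleCount.variety I ∧ z k = w}.ncard) ∧
        UnitCircleCount.unitCircleRootCount (UnitCircleCount.elimResultant f (g k)) =
          UnitCircleCount.unitCount I k) := by
  refine ⟨?_, fun n I hI a f g h hf k =>
    ⟨UnitCircleCount.exists_map_elimResultant_eq hI h hf k,
      UnitCircleCount.rootMultiplicity_map_elimResultant hI h hf k,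
      UnitCircleCount.unitCircleRootCount_elimResultant hI h hf k⟩⟩
  obtain ⟨univRep, hU, hU', hdom⟩ := UnitCircleCount.exists_partrec_isUnivariateRepresentation
  obtain ⟨res, hres, hres'⟩ := UnitCircleCount.exists_computable_elimResultant
  obtain ⟨count, hcount, hcount'⟩ := UnitCircleCount.exists_computable_unitCircleRootCount
  refine ⟨fun x => (univRep x.1).map fun u => count (res (u, x.2)), univRep, res, count, ?_, hU,
    hres, hcount, fun s k => rfl, hres', hcount', fun n ps hI => ?_⟩
  · exact (hU.comp Computable.fst).map (hcount.comp (hres.comp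
      (Computable.snd.pair (Computable.snd.comp Computable.fst))))
  · obtain ⟨u, hu⟩ := Part.dom_iff_mem.1 (hdom n ps hI)
    obtain ⟨h, hf⟩ := hU' n ps u hu
    refine ⟨⟨u, hu, h, hf⟩, fun k => ?_⟩
    -- `count` is specified only for nonzero polynomials.
    have hk := UnitCircleCount.elimResultant_ne_zero hI h hf k
    rw [← hres'] at hk
    dsimp only
    rw [Part.eq_some_iff.2 hu, Part.map_some, hcount' _ hk, hres',
      UnitCircleCount.unitCircleRootCount_elimResultant hI h hf k]
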